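/- Let $\Omega_C=\{\omega\in C(\mathbb R,\mathbb R):\omega(0)=0\}$ carry the compact-open topology, its Borel $\sigma$-algebra, the two-sided Wiener measure $P$ and the shifts $\theta_t\omega=\omega(\cdot+t)-\omega(t)$. Let $\Omega\subseteq\Omega_C$ be a measurable $\theta$-invariant set with $P(\Omega)=1$ such that $\omega(t)/t\to0$ as $t\to\pm\infty$ for every $\omega\in\Omega$; equip $\Omega$ with the trace $\sigma$-algebra and the restriction of $P$. Let $\delta>0$ and $0<\alpha<\nu$, let $f:\mathbb R\times\mathbb R\to\mathbb R$ be smooth and let $g,h\in L^1_{\rm loc}(\mathbb R)$ be such that (f1) $f(t,0)=0$ and $f(t,x)x\le-\nu x^2+h(t)|x|$ for all $t,x\in\mathbb R$; (g1) $\int_{-\infty}^{\tau}e^{\alpha t}(|g(t)|+|h(t)|)\,dt<\infty$ for all $\tau\in\mathbb R$; (g2) $\lim_{s\to-\infty}e^{(c-\alpha)s}\int_{-\infty}^{s+\tau}e^{\alpha t}(|g(t)|+|h(t)|)\,dt=0$ for all $c>0$, $\tau\in\mathbb R$. Consider the Stratonovich equation $\frac{dx}{dt}=f(t,x)+g(t)+\delta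 x\circ\frac{d\omega}{dt}$, $t>\tau$, $x(\tau)=x_\tau$. For every $\tau\in\mathbb R$, $\omega\in\Omega$, $x_\tau\in\mathbb R$ there is exactly one continuous $x=x(\cdot,\tau,\omega,x_\tau)$ on $[\tau,\infty)$ that solves it pathwise, that is, $$e^{-\delta\omega(t)}x(t)=e^{-\delta\omega(\tau)}x_\tau+\int_\tau^t e^{-\delta\omega(s)}\big(f(s,x(s))+g(s)\big)\,ds,\qquad t\ge\tau .$$ For each $\tau,x_\tau$, the process $(t,\omega)\mapsto x(t,\tau,\omega,x_\tau)$ has continuous paths, is adapted to the increments of $\omega$ after time $\tau$, and satisfies for each $t\ge\tau$, almost surely, $x(t)=x_\tau+\int_\tau^t(f(s,x(s))+g(s))\,ds+\delta\int_\tau^t x(s)\circ d\omega(s)$, where the Stratonovich integral is the limit in probability of the sums $\sum_i\frac12(x(t_i)+x(t_{i+1}))(\omega(t_{i+1})-\omega(t_i))$ along partitions of $[\tau,t]$ whose mesh tends to $0$. Moreover $\Phi(t,\tau,\omega,x_\tau)=x(t+\tau,\tau,\theta_{-\tau}\omega,x_\tau)$, $t\ge0$, is a continuous cocycle on $\mathbb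 R$: for each $\tau$ it is jointly measurable in $(t,\omega,x)$, it is continuous in $x$, $\Phi(0,\tau,\omega,\cdot)$ is the identity, and $\Phi(t+s,\tau,\omega,\cdot)=\Phi(t,\tau+s,\theta_s\omega,\cdot)\circ\Phi(s,\tau,\omega,\cdot)$. Let $\mathcal D$ be the collection of all families $D=\{D(\tau,\omega)\}_{\tau\in\mathbb R,\omega\in\Omega}$ of bounded nonempty subsets of $\mathbb R$ that are tempered: $\lim_{t\to-\infty}e^{ct}\sup\{|x|:x\in D(\tau+t,\theta_t\omega)\}=0$ for all $c>0$, $\tau$, $\omega$. A $\mathcal D$-pullback attractor of $\Phi$ is a family $\mathcal A\in\mathcal D$ of compact sets such that, for all $\tau\in\mathbb R$, $\omega\mapsto{\rm dist}(x,\mathcal A(\tau,\omega))$ is measurable for every $x\in\mathbb R$; $\Phi(t,\tau,\omega,\mathcal A(\tau,\omega))=\mathcal A(\tau+t,\theta_t\omega)$ for all $t\ge0$, $\omega\in\Omega$; and for every $B\in\mathcal D$ and $\omega\in\Omega$ the Hausdorff semi-distance from $\Phi(t,\tau-t,\theta_{-t}\omega,B(\tau-t,\theta_{-t}\omega))$ to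 $\mathcal A(\tau,\omega)$ tends to $0$ as $t\to\infty$. A $\mathcal D$-complete quasi-solution of $\Phi$ is a map $\xi:\mathbb R\times\Omega\to\mathbb R$ with $\Phi(t,\tau,\omega,\xi(\tau,\omega))=\xi(\tau+t,\theta_t\omega)$ for all $t\ge0$, $\tau$, $\omega$, for which some $D\in\mathcal D$ satisfies $\xi(\tau,\omega)\in D(\tau,\omega)$ for all $\tau,\omega$. Then $\Phi$ has a unique $\mathcal D$-pullback attractor $\mathcal A\in\mathcal D$, and for every $\tau\in\mathbb R$, $\omega\in\Omega$, $$\mathcal A(\tau,\omega)=\{\xi(\tau,\omega):\xi\text{ is a }\mathcal D\text{-complete quasi-solution of }\Phi\}.$$ -/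

import Mathlib

open MeasureTheory ProbabilityTheory Filter Topology Set
open scoped NNReal ENNReal

/-! ### Cocycles, complete quasi-solutions and pullback attractors -/

section Abstract

variable {Ω X : Type*}

/-- Continuous cocycle on `X` over `ℝ` and the flow `θ` on the measurable space `Ω`:
(i) joint measurability in (time, sample, state), (ii) identity at time zero,
(iii) cocycle property, (iv) continuity in the state. -/
structure IsContinuousCocycle [MeasurableSpace Ω] [TopologicalSpace X] [MeasurableSpace X]
    (θ : ℝ → Ω → Ω) (Φ : ℝ≥0 → ℝ → Ω → X → X) : Prop where
  measurable : ∀ τ, Measurable (fun p : ℝ≥0 × Ω × X => Φ p.1 τ p.2.1 p.2.2)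
  zero : ∀ τ ω x, Φ 0 τ ω x = x
  cocycle : ∀ (t s : ℝ≥0) (τ : ℝ) (ω : Ω) (x : X),
    Φ (t + s) τ ω x = Φ t (τ + s) (θ s ω) (Φ s τ ω x)
  continuous : ∀ t τ ω, Continuous (Φ t τ ω)

/-- Complete quasi-solution: `Φ(t, τ, ω, ξ(τ, ω)) = ξ(τ + t, θ_t ω)` for all `t ≥ 0`, `τ`, `ω`. -/
def IsCompleteQuasiSolution (θ : ℝ → Ω → Ω) (Φ : ℝ≥0 → ℝ → Ω → X → X) (ξ : ℝ → Ω → X) : Prop :=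
  ∀ (t : ℝ≥0) (τ : ℝ) (ω : Ω), Φ t τ ω (ξ τ ω) = ξ (τ + t) (θ t ω)

/-- `𝒟`-complete quasi-solution: a complete quasi-solution with values in a member of `𝒟`. -/
def IsDCompleteQuasiSolution (θ : ℝ → Ω → Ω) (𝒟 : Set (ℝ → Ω → Set X))
    (Φ : ℝ≥0 → ℝ → Ω → X → X) (ξ : ℝ → Ω → X) : Prop :=
  IsCompleteQuasiSolution θ Φ ξ ∧ ∃ D ∈ 𝒟, ∀ τ ω, ξ τ ω ∈ D τ ω

/-- Hausdorff semi-distance `sup_{a ∈ S} inf_{b ∈ T} d(a, b)`, with values in `[0, ∞]`. -/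
noncomputable def hausdorffSemiEDist [PseudoEMetricSpace X] (S T : Set X) : ℝ≥0∞ :=
  ⨆ a ∈ S, Metric.infEDist a T

/-- `𝒟`-pullback attractor. Measurability is that of random sets: for every `τ` and `x` the
distance from `x` to `A(τ, ω)` is measurable in `ω`. -/
structure IsPullbackAttractor [MeasurableSpace Ω] [PseudoMetricSpace X]
    (θ : ℝ → Ω → Ω) (𝒟 : Set (ℝ → Ω → Set X)) (Φ : ℝ≥0 → ℝ → Ω → X → X)
    (A : ℝ → Ω → Set X) : Prop where
  mem : A ∈ 𝒟
  measurable : ∀ τ x, Measurable (fun ω => Metric.infDist x (A τ ω))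
  isCompact : ∀ τ ω, IsCompact (A τ ω)
  invariant : ∀ (t : ℝ≥0) τ ω, Φ t τ ω '' A τ ω = A (τ + t) (θ t ω)
  attracts : ∀ B ∈ 𝒟, ∀ τ ω,
    Tendsto (fun t : ℝ≥0 => hausdorffSemiEDist
      (Φ t (τ - t) (θ (-t) ω) '' B (τ - t) (θ (-t) ω)) (A τ ω)) atTop (𝓝 0)

/-- The collection of all tempered families of bounded nonempty subsets of `ℝ`:
`e^{ct} ‖D(τ + t, θ_t ω)‖ → 0` as `t → -∞` for all `c > 0`, where `‖I‖ = sup_{x ∈ I} |x|`. -/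
def temperedFamilies (θ : ℝ → Ω → Ω) : Set (ℝ → Ω → Set ℝ) :=
  {D | (∀ τ ω, (D τ ω).Nonempty ∧ Bornology.IsBounded (D τ ω)) ∧
    ∀ c > 0, ∀ τ ω,
      Tendsto (fun t : ℝ => Real.exp (c * t) * sSup ((fun x => |x|) '' D (τ + t) (θ t ω)))
        atBot (𝓝 0)}

end Abstract

/-! ### The Wiener space -/

/-- The Borel σ-algebra of the compact-open topology. -/
instance instMeasurableSpaceContPath : MeasurableSpace C(ℝ, ℝ) := borel C(ℝ, ℝ)

instance instBorelSpaceContPath : BorelSpace C(ℝ, ℝ) := ⟨rfl⟩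

/-- Continuous paths `ω : ℝ → ℝ` with `ω(0) = 0`, with the compact-open topology and its
Borel σ-algebra (both induced from `C(ℝ, ℝ)`). -/
abbrev WienerPath : Type := {ω : C(ℝ, ℝ) // ω 0 = 0}

/-- The Wiener shift `θ_t ω = ω(· + t) - ω(t)`. -/
def wienerShift (t : ℝ) (ω : WienerPath) : WienerPath :=
  ⟨⟨fun s => ω.1 (s + t) - ω.1 t, by fun_prop⟩, by simp⟩

/-- The Wiener shift on a shift-invariant set of paths. -/
def wienerShiftOn (Ω₀ : Set WienerPath) (hinv : ∀ t, ∀ ω ∈ Ω₀, wienerShift t ω ∈ Ω₀)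
    (t : ℝ) (ω : Ω₀) : Ω₀ :=
  ⟨wienerShift t ω.1, hinv t ω.1 ω.2⟩

/-- `P` is the (two-sided) Wiener measure: under `P` the increments over successive time
intervals are independent, and `ω(t) - ω(s)` is centred Gaussian with variance `t - s`. -/
structure IsWienerMeasure (P : Measure WienerPath) : Prop where
  isProbabilityMeasure : IsProbabilityMeasure P
  indep_increments : HasIndepIncrements (fun (t : ℝ) (ω : WienerPath) => ω.1 t) P
  law_increment : ∀ s t : ℝ, s ≤ t →
    HasLaw (fun ω : WienerPath => ω.1 t - ω.1 s) (gaussianReal 0 (t - s).toNNReal) P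

/-! ### The Stratonovich equation `dx/dt = F(t, x) + δ x ∘ dω/dt` -/

/-- Pathwise solution of `dx/dt = F(t, x) + δ x ∘ dω/dt`, `x(τ) = x₀`, on `[τ, ∞)` along the
path `ω`: by the Stratonovich product rule the equation reads
`d(e^{-δ ω(t)} x) = e^{-δ ω(t)} F(t, x) dt`, and this is required in integrated form.
For `F(t, x) = -ν x + q(t)` this is the variation of constants formula. -/
def IsPathwiseSolution (F : ℝ → ℝ → ℝ) (δ : ℝ) (ω : ℝ → ℝ) (τ x₀ : ℝ) (x : ℝ → ℝ) : Prop :=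
  ContinuousOn x (Ici τ) ∧ ∀ t, τ ≤ t →
    Real.exp (-δ * ω t) * x t = Real.exp (-δ * ω τ) * x₀ +
      ∫ s in τ..t, Real.exp (-δ * ω s) * F s (x s)

section Equation

variable {Ω₀ : Set WienerPath}

/-- The process `x(t, τ, ω, x₀) = Φ(t - τ, τ, θ_τ ω, x₀)`, `t ≥ τ`; equivalently
`Φ(t, τ, ω, x₀) = x(t + τ, τ, θ_{-τ} ω, x₀)`. -/
noncomputable def cocycleProcess (θ : ℝ → Ω₀ → Ω₀) (Φ : ℝ≥0 → ℝ → Ω₀ → ℝ → ℝ) (τ x₀ t : ℝ)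
    (ω : Ω₀) : ℝ :=
  Φ (t - τ).toNNReal τ (θ τ ω) x₀

/-- `Φ` is the solution cocycle: for every `τ`, every initial value `x₀` and **every** path
`ω ∈ Ω₀`, the function `t ↦ x(t, τ, ω, x₀)` is the pathwise solution along `ω`. -/
def IsSolutionCocycle (θ : ℝ → Ω₀ → Ω₀) (F : ℝ → ℝ → ℝ) (δ : ℝ)
    (Φ : ℝ≥0 → ℝ → Ω₀ → ℝ → ℝ) : Prop :=
  ∀ τ x₀ (ω : Ω₀),
    IsPathwiseSolution F δ (fun t => ω.1.1 t) τ x₀ (fun t => cocycleProcess θ Φ τ x₀ t ω)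

/-- `I` is the Stratonovich integral `∫_a^b Y ∘ dW`: the limit in probability of the sums
`∑ (Y(tᵢ) + Y(tᵢ₊₁))/2 · (W(tᵢ₊₁) - W(tᵢ))` along every sequence of partitions
`a = p n 0 ≤ ⋯ ≤ p n (m n) = b` whose mesh tends to zero. -/
def IsStratonovichIntegral {Ω : Type*} [MeasurableSpace Ω] (P : Measure Ω) (W Y : ℝ → Ω → ℝ)
    (a b : ℝ) (I : Ω → ℝ) : Prop :=
  ∀ (m : ℕ → ℕ) (p : ℕ → ℕ → ℝ), (∀ n, Monotone (p n)) → (∀ n, p n 0 = a) →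
    (∀ n, p n (m n) = b) →
    (∀ ε > 0, ∀ᶠ n in atTop, ∀ i < m n, p n (i + 1) - p n i < ε) →
    TendstoInMeasure P
      (fun n ω => ∑ i ∈ Finset.range (m n),
        (Y (p n i) ω + Y (p n (i + 1)) ω) / 2 * (W (p n (i + 1)) ω - W (p n i) ω))
      atTop I

/-- `Y` is a strong solution on `[τ, ∞)` of the Stratonovich stochastic differential equation
`dY = F(t, Y) dt + δ Y ∘ dW`, `Y(τ) = x₀`: it has continuous paths, it is adapted to the
increments of `W` after time `τ`, and the integral equation holds almost surely. -/
structure IsStratonovichSolution {Ω : Type*} [MeasurableSpace Ω] (P : Measure Ω)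
    (W : ℝ → Ω → ℝ) (F : ℝ → ℝ → ℝ) (δ τ x₀ : ℝ) (Y : ℝ → Ω → ℝ) : Prop where
  continuousOn : ∀ ω, ContinuousOn (fun t => Y t ω) (Ici τ)
  adapted : ∀ t, τ ≤ t →
    Measurable[⨆ r ∈ Icc τ t, MeasurableSpace.comap (fun ω => W r ω - W τ ω) inferInstance] (Y t)
  integral_eq : ∀ t, τ ≤ t → ∃ I : Ω → ℝ, IsStratonovichIntegral P W Y τ t I ∧
    ∀ᵐ ω ∂P, Y t ω = x₀ + (∫ s in τ..t, F s (Y s ω)) + δ * I ω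

end Equation

/-! In the variable `y = e^{-δω} x` the noise term disappears, and a pathwise solution is a solution
of a random Carathéodory equation. For a fixed continuous path everything is deterministic:
existence comes from Picard-Lindelöf applied to a truncated equation (`exists_solvesOn`), and local
Lipschitz dependence on path and initial value from Grönwall (`SolvesOn.exists_lipschitz`). Adding a
constant to the path changes nothing, so the solution is a continuous functional of the increments;
this yields the cocycle property, measurability and adaptedness.

The Stratonovich identity is also obtained path by path. The product rule for `x = e^{δω} y` is
exact for the trapezoidal sums up to a term controlled by the moduli of continuity and one
controlled by the cubic variation `∑ |Δω|³`. The latter has expectation of order `∑ |Δt|^{3/2}`, so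
it tends to zero in probability, and almost surely along a subsequence.

The attractor rests on the order of the line. Two solutions that meet coincide backwards in time as
well, so each `Φ t τ ω` is strictly increasing (`strictMono_solution`). Dissipativity compares `|x|`
with the linear equation with damping `ν` and forcing `Q = |g| + |h| + 1`; the pullback limit of the
latter, `radius`, is tempered, since paths grow sublinearly, and the interval `[-radius, radius]` is
positively invariant and absorbing. Pulling its two endpoints back from the remote past therefore
gives a decreasing and an increasing bounded family, with limits `u` and `l`. Both are complete
quasi-solutions, measurable as limits of sequences, and the attractor is the interval between them
(`exists_isPullbackAttractor_of_strictMono`).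

An attractor is its own image from every past time, so any two attractors attract, hence contain,
each other. Every point of the attractor has a unique backward orbit inside it, and gluing that
orbit to `u` off the orbit gives a `𝒟`-complete quasi-solution; conversely such a solution is
attracted by the attractor from all past times. -/

/-! ### Integral inequalities -/

/-- Grönwall's inequality in integral form. -/
theorem le_mul_exp_of_le_add_mul_integral {u : ℝ → ℝ} {a b ε K : ℝ} (hab : a ≤ b)
    (hu : ContinuousOn u (Icc a b)) (hK : 0 ≤ K)
    (h : ∀ t ∈ Icc a b, u t ≤ ε + K * ∫ s in a..t, u s) :
    ∀ t ∈ Icc a b, u t ≤ ε * Real.exp (K * (t - a)) := by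
  -- The constant extension beyond `[a, b]` makes the primitive differentiable at every point, the
  -- endpoints included.
  set v : ℝ → ℝ := IccExtend hab ((Icc a b).domRestrict u) with hv
  have hvc : Continuous v := (continuousOn_iff_continuous_domRestrict.1 hu).Icc_extend'
  have hvu : ∀ t ∈ Icc a b, v t = u t := fun t ht => by
    rw [hv, IccExtend_of_mem hab _ ht]; rfl
  have hint : ∀ t ∈ Icc a b, ∫ s in a..t, u s = ∫ s in a..t, v s := fun t ht => by
    refine intervalIntegral.integral_congr fun s hs => ?_
    rw [uIcc_of_le ht.1] at hs
    exact (hvu s ⟨hs.1, hs.2.trans ht.2⟩).symm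
  have hφ : ∀ t, HasDerivAt (fun t => ∫ s in a..t, v s) (v t) t := fun t =>
    intervalIntegral.integral_hasDerivAt_right (hvc.intervalIntegrable _ _)
      (hvc.stronglyMeasurableAtFilter _ _) hvc.continuousAt
  -- The differential form of Grönwall is applied to the primitive `φ` of `v`, for which the
  -- hypothesis reads `φ' ≤ K φ + ε`; `u` itself need not be differentiable.
  have key := le_gronwallBound_of_liminf_deriv_right_le (f := fun t => ∫ s in a..t, v s)
    (f' := v) (δ := 0) (K := K) (ε := ε) (a := a) (b := b)
    (fun t _ => (hφ t).continuousAt.continuousWithinAt)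
    (fun t _ r hr => by
      simpa [slope_def_field, div_eq_inv_mul] using
        (hφ t).hasDerivWithinAt.liminf_right_slope_le hr) (by simp)
    (fun t ht => by
      have := h t (Ico_subset_Icc_self ht)
      rw [hint t (Ico_subset_Icc_self ht), ← hvu t (Ico_subset_Icc_self ht)] at this
      linarith)
  intro t ht
  have h1 := h t ht
  rw [hint t ht] at h1
  have h2 := mul_le_mul_of_nonneg_left (key t ht) hK
  refine h1.trans ((add_le_add_right h2 ε).trans (le_of_eq ?_))
  rcases eq_or_lt_of_le hK with rfl | hK'
  · simp
  · rw [gronwallBound_of_K_ne_0 hK'.ne']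
    field_simp
    ring

/-- Comparison principle: if `y` starts below `m` and grows no faster than `m` on every interval
on which it lies above `m`, then it stays below `m`. -/
theorem le_of_sub_le_sub_of_lt {y m : ℝ → ℝ} {a b : ℝ} (hy : ContinuousOn y (Icc a b))
    (hm : ContinuousOn m (Icc a b)) (ha : y a ≤ m a)
    (h : ∀ s t, a ≤ s → s ≤ t → t ≤ b → (∀ r ∈ Ioc s t, m r < y r) → y t - y s ≤ m t - m s) :
    ∀ t ∈ Icc a b, y t ≤ m t := by
  intro t ht
  by_contra! hlt
  -- After the last time of `S` the function `y` stays above `m` up to `t`, so the growth hypothesis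
  -- applies there and contradicts `m t < y t`.
  set S := {s | s ∈ Icc a t ∧ y s ≤ m s} with hS
  have hsub : Icc a t ⊆ Icc a b := Icc_subset_Icc_right ht.2
  have hcl : IsClosed S := isClosed_Icc.isClosed_le (hy.mono hsub) (hm.mono hsub)
  have hne : S.Nonempty := ⟨a, ⟨le_refl a, ht.1⟩, ha⟩
  have hbdd : BddAbove S := ⟨t, fun s hs => hs.1.2⟩
  obtain ⟨⟨h1, h2⟩, h3⟩ := hcl.csSup_mem hne hbdd
  have := h (sSup S) t h1 h2 ht.2 fun r hr => by
    by_contra! hle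
    exact absurd (le_csSup hbdd ⟨⟨h1.trans hr.1.le, hr.2⟩, hle⟩) (not_le.2 hr.1)
  linarith

/-- Variation of constants: `e^{-νt} U(t)` solves `m' = -ν m + e^{-νt} U'(t)`. -/
theorem exp_neg_mul_sub_eq_integral {U β : ℝ → ℝ} {s t : ℝ} (ν : ℝ) (hst : s ≤ t)
    (hβ : IntervalIntegrable β volume s t)
    (hU : ∀ r ∈ Icc s t, U r = U s + ∫ q in s..r, β q) :
    Real.exp (-ν * t) * U t - Real.exp (-ν * s) * U s =
      ∫ r in s..t, (-ν * (Real.exp (-ν * r) * U r) + Real.exp (-ν * r) * β r) := by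
  set V : ℝ → ℝ := fun r => U s + ∫ q in s..r, β q with hV
  -- Since `β` is only integrable, the product rule holds almost everywhere and is integrated by
  -- absolute continuity.
  have hac : AbsolutelyContinuousOnInterval V s t := by
    have h1 : AbsolutelyContinuousOnInterval (fun _ : ℝ => U s) s t :=
      ContDiffOn.absolutelyContinuousOnInterval contDiffOn_const
    exact h1.add (hβ.absolutelyContinuousOnInterval_intervalIntegral (c := s) left_mem_uIcc)
  have hexp : AbsolutelyContinuousOnInterval (fun r => Real.exp (-ν * r)) s t :=
    ContDiffOn.absolutelyContinuousOnInterval (by fun_prop)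
  have key := hexp.integral_deriv_mul_eq_sub hac
  rw [hU t ⟨hst, le_rfl⟩]
  have hs : U s = V s := by simp [hV]
  calc _ = Real.exp (-ν * t) * V t - Real.exp (-ν * s) * V s := by rw [← hs]
    _ = _ := by
      rw [← key]
      refine intervalIntegral.integral_congr_ae ?_
      filter_upwards [hβ.ae_hasDerivAt_integral] with r hr hr'
      have hr'' : r ∈ uIcc s t := uIoc_subset_uIcc hr'
      have d1 : HasDerivAt (fun r => Real.exp (-ν * r)) (Real.exp (-ν * r) * -ν) r := by
        simpa using ((hasDerivAt_id r).const_mul (-ν)).exp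
      have d2 : HasDerivAt V (β r) r := (hr hr'' s left_mem_uIcc).const_add _
      rw [d1.deriv, d2.deriv, hU r (by rwa [uIcc_of_le hst] at hr'')]
      ring

theorem MeasureTheory.LocallyIntegrable.intervalIntegrable_of_real {g : ℝ → ℝ}
    (hg : LocallyIntegrable g) {a b : ℝ} : IntervalIntegrable g volume a b :=
  (hg.integrableOn_isCompact isCompact_uIcc).intervalIntegrable

/-! ### Pathwise solutions on compact intervals -/

/-- Pathwise solution of `dx/dt = F(t, x) + δ x ∘ dw/dt`, `x(a) = x₀`, on `[a, b]`. -/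
def SolvesOn (F : ℝ → ℝ → ℝ) (δ : ℝ) (w : ℝ → ℝ) (a b x₀ : ℝ) (x : ℝ → ℝ) : Prop :=
  ContinuousOn x (Icc a b) ∧ ∀ t ∈ Icc a b,
    Real.exp (-δ * w t) * x t = Real.exp (-δ * w a) * x₀ +
      ∫ s in a..t, Real.exp (-δ * w s) * F s (x s)

theorem IsPathwiseSolution.solvesOn {F : ℝ → ℝ → ℝ} {δ τ x₀ : ℝ} {w x : ℝ → ℝ}
    (hx : IsPathwiseSolution F δ w τ x₀ x) (b : ℝ) : SolvesOn F δ w τ b x₀ x :=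
  ⟨hx.1.mono Icc_subset_Ici_self, fun t ht => hx.2 t ht.1⟩

namespace SolvesOn

variable {F : ℝ → ℝ → ℝ} {δ a b x₀ ν : ℝ} {w x q m : ℝ → ℝ}

theorem initial (hx : SolvesOn F δ w a b x₀ x) (hab : a ≤ b) : x a = x₀ := by
  have := hx.2 a ⟨le_rfl, hab⟩
  simpa using this

theorem mono {b' : ℝ} (hx : SolvesOn F δ w a b x₀ x) (hb : b' ≤ b) : SolvesOn F δ w a b' x₀ x :=
  ⟨hx.1.mono (Icc_subset_Icc_right hb), fun t ht => hx.2 t ⟨ht.1, ht.2.trans hb⟩⟩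

/-- The equation is invariant under reflection of the state, so lower bounds follow from upper
bounds. -/
theorem neg (hx : SolvesOn F δ w a b x₀ x) :
    SolvesOn (fun t y => -F t (-y)) δ w a b (-x₀) (fun t => -x t) := by
  refine ⟨hx.1.neg, fun t ht => ?_⟩
  have := hx.2 t ht
  simp only [neg_neg, mul_neg, intervalIntegral.integral_neg]
  linarith

/-- Only the increments of the path on the interval matter. -/
theorem congr_path {w' : ℝ → ℝ} {c : ℝ} (hx : SolvesOn F δ w a b x₀ x)
    (h : ∀ s ∈ Icc a b, w' s = w s + c) : SolvesOn F δ w' a b x₀ x := by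
  refine ⟨hx.1, fun t ht => ?_⟩
  have e : ∀ s ∈ Icc a b, Real.exp (-δ * w' s) = Real.exp (-δ * c) * Real.exp (-δ * w s) := by
    intro s hs
    rw [h s hs, ← Real.exp_add]
    ring_nf
  have hi : ∫ s in a..t, Real.exp (-δ * w' s) * F s (x s) =
      Real.exp (-δ * c) * ∫ s in a..t, Real.exp (-δ * w s) * F s (x s) := by
    rw [← intervalIntegral.integral_const_mul]
    refine intervalIntegral.integral_congr fun s hs => ?_
    rw [uIcc_of_le ht.1] at hs
    simp only [e s ⟨hs.1, hs.2.trans ht.2⟩, mul_assoc]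
  rw [hi, e t ht, e a ⟨le_rfl, ht.1.trans ht.2⟩, mul_assoc, hx.2 t ht]
  ring

theorem sub_eq_integral (hx : SolvesOn F δ w a b x₀ x)
    (hF : IntervalIntegrable (fun s => Real.exp (-δ * w s) * F s (x s)) volume a b)
    {s t : ℝ} (has : a ≤ s) (hst : s ≤ t) (htb : t ≤ b) :
    Real.exp (-δ * w t) * x t - Real.exp (-δ * w s) * x s =
      ∫ r in s..t, Real.exp (-δ * w r) * F r (x r) := by
  rw [hx.2 t ⟨has.trans hst, htb⟩, hx.2 s ⟨has, hst.trans htb⟩,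
    ← intervalIntegral.integral_add_adjacent_intervals (a := a) (b := s) (c := t)]
  · ring
  · exact hF.mono_set (by
      rw [uIcc_of_le has, uIcc_of_le (has.trans (hst.trans htb))]
      exact Icc_subset_Icc_right (hst.trans htb))
  · exact hF.mono_set (by
      rw [uIcc_of_le hst, uIcc_of_le (has.trans (hst.trans htb))]
      exact Icc_subset_Icc has htb)

theorem restart (hx : SolvesOn F δ w a b x₀ x)
    (hF : IntervalIntegrable (fun s => Real.exp (-δ * w s) * F s (x s)) volume a b)
    {s : ℝ} (has : a ≤ s) : SolvesOn F δ w s b (x s) x :=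
  ⟨hx.1.mono (Icc_subset_Icc_left has), fun t ht => by
    rw [← hx.sub_eq_integral hF has ht.1 ht.2]; ring⟩

/-- One-sided a priori bound by a solution of the linear equation. -/
theorem exp_mul_le (hx : SolvesOn F δ w a b x₀ x) (hw : ContinuousOn w (Icc a b))
    (hF : IntervalIntegrable (fun s => Real.exp (-δ * w s) * F s (x s)) volume a b)
    (hq : IntervalIntegrable (fun s => Real.exp (-δ * w s) * q s) volume a b) (hν : 0 ≤ ν)
    (hdiss : ∀ s y, 0 < y → F s y ≤ -ν * y + q s)
    (hm : ContinuousOn m (Icc a b)) (hm0 : ∀ t ∈ Icc a b, 0 ≤ m t)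
    (hma : Real.exp (-δ * w a) * x₀ ≤ m a)
    (hmeq : ∀ s t, a ≤ s → s ≤ t → t ≤ b →
      m t - m s = ∫ r in s..t, (-ν * m r + Real.exp (-δ * w r) * q r)) :
    ∀ t ∈ Icc a b, Real.exp (-δ * w t) * x t ≤ m t := by
  intro t ht
  have hab := ht.1.trans ht.2
  have hy : ContinuousOn (fun t => Real.exp (-δ * w t) * x t) (Icc a b) :=
    ((continuousOn_const.mul hw).rexp).mul hx.1
  refine le_of_sub_le_sub_of_lt hy hm (by rw [hx.initial hab]; exact hma)
    (fun s t has hst htb hlt => ?_) t ht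
  rw [hx.sub_eq_integral hF has hst htb, hmeq s t has hst htb]
  have hsub : uIcc s t ⊆ uIcc a b := by
    rw [uIcc_of_le hst, uIcc_of_le hab]
    exact Icc_subset_Icc has htb
  have hmi : IntervalIntegrable m volume s t := (hm.mono (by
    rw [← uIcc_of_le hab]; exact hsub)).intervalIntegrable
  refine intervalIntegral.integral_mono_on_of_le_Ioo hst (hF.mono_set hsub)
    ((hmi.const_mul _).add (hq.mono_set hsub)) fun r hr => ?_
  have hr' : r ∈ Icc a b := ⟨has.trans hr.1.le, hr.2.le.trans htb⟩
  have h1 := hlt r ⟨hr.1, hr.2.le⟩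
  have h2 := hm0 r hr'
  have hE := Real.exp_pos (-δ * w r)
  -- Only where `y` exceeds the nonnegative majorant is a bound needed, and there the state is
  -- positive, so the one-sided hypothesis on `F` suffices.
  have hxr : 0 < x r := by
    by_contra! hle
    have := mul_nonpos_of_nonneg_of_nonpos hE.le hle
    linarith
  have h3 := mul_le_mul_of_nonneg_left (hdiss r (x r) hxr) hE.le
  have h4 := mul_le_mul_of_nonneg_left h1.le hν
  nlinarith

/-- A priori bound by a solution of the linear equation. -/
theorem exp_mul_abs_le (hx : SolvesOn F δ w a b x₀ x) (hw : ContinuousOn w (Icc a b))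
    (hF : IntervalIntegrable (fun s => Real.exp (-δ * w s) * F s (x s)) volume a b)
    (hq : IntervalIntegrable (fun s => Real.exp (-δ * w s) * q s) volume a b) (hν : 0 ≤ ν)
    (hdiss : ∀ s y, 0 < y → F s y ≤ -ν * y + q s)
    (hdiss' : ∀ s y, y < 0 → -ν * y - q s ≤ F s y)
    (hm : ContinuousOn m (Icc a b)) (hm0 : ∀ t ∈ Icc a b, 0 ≤ m t)
    (hma : Real.exp (-δ * w a) * |x₀| ≤ m a)
    (hmeq : ∀ s t, a ≤ s → s ≤ t → t ≤ b →
      m t - m s = ∫ r in s..t, (-ν * m r + Real.exp (-δ * w r) * q r)) :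
    ∀ t ∈ Icc a b, Real.exp (-δ * w t) * |x t| ≤ m t := by
  intro t ht
  have hE := Real.exp_pos (-δ * w t)
  have hEa := Real.exp_pos (-δ * w a)
  have h1 := hx.exp_mul_le hw hF hq hν hdiss hm hm0
    ((mul_le_mul_of_nonneg_left (le_abs_self _) hEa.le).trans hma) hmeq t ht
  have h2 := hx.neg.exp_mul_le hw (by simpa only [neg_neg, mul_neg] using! hF.neg) hq hν
    (fun s y hy => by have := hdiss' s (-y) (by linarith); linarith) hm hm0
    ((mul_le_mul_of_nonneg_left (neg_le_abs _) hEa.le).trans hma) hmeq t ht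
  rcases abs_choice (x t) with h | h <;> rw [h] <;> assumption

end SolvesOn

/-! ### Stability and uniqueness -/

/-- A `C¹` function is Lipschitz on a compact box. The slots are time, value of the path and
conjugated state; the two points share the time. -/
theorem exists_abs_sub_le_of_contDiff {Ψ : ℝ → ℝ → ℝ → ℝ}
    (h : ContDiff ℝ 1 (fun p : ℝ × ℝ × ℝ => Ψ p.1 p.2.1 p.2.2)) (a b N : ℝ) :
    ∃ L, 0 ≤ L ∧ ∀ s ∈ Icc a b, ∀ p p' y y', |p| ≤ N → |p'| ≤ N → |y| ≤ N → |y'| ≤ N →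
      |Ψ s p y - Ψ s p' y'| ≤ L * (|p - p'| + |y - y'|) := by
  have hK : IsCompact (Icc a b ×ˢ Icc (-N) N ×ˢ Icc (-N) N) :=
    isCompact_Icc.prod (isCompact_Icc.prod isCompact_Icc)
  obtain ⟨L, hL⟩ := (h.locallyLipschitz.locallyLipschitzOn
    (s := Icc a b ×ˢ Icc (-N) N ×ˢ Icc (-N) N)).exists_lipschitzOnWith_of_compact hK
  refine ⟨L, L.2, fun s hs p p' y y' hp hp' hy hy' => ?_⟩
  have := hL.dist_le_mul (s, p, y) ⟨hs, abs_le.1 hp, abs_le.1 hy⟩ (s, p', y')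
    ⟨hs, abs_le.1 hp', abs_le.1 hy'⟩
  simp only [Prod.dist_eq, dist_self, Real.dist_eq] at this
  refine this.trans (mul_le_mul_of_nonneg_left ?_ L.2)
  have h1 := abs_nonneg (p - p')
  have h2 := abs_nonneg (y - y')
  exact max_le (by linarith) (max_le (by linarith) (by linarith))

section Coefficients

variable {f : ℝ → ℝ → ℝ} {g : ℝ → ℝ} {δ : ℝ}

theorem intervalIntegrable_exp_mul_add (hf : Continuous (fun p : ℝ × ℝ => f p.1 p.2))
    (hg : LocallyIntegrable g) {w x : ℝ → ℝ} {a b : ℝ} (hw : ContinuousOn w (Icc a b))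
    (hx : ContinuousOn x (Icc a b)) (hab : a ≤ b) :
    IntervalIntegrable (fun s => Real.exp (-δ * w s) * (f s (x s) + g s)) volume a b := by
  have hE : ContinuousOn (fun s => Real.exp (-δ * w s)) (uIcc a b) := by
    rw [uIcc_of_le hab]; exact (continuousOn_const.mul hw).rexp
  have hfx : ContinuousOn (fun s => f s (x s)) (uIcc a b) := by
    rw [uIcc_of_le hab]
    exact hf.comp_continuousOn (continuousOn_id.prodMk hx)
  exact (hfx.intervalIntegrable.add (hg.intervalIntegrable_of_real)).continuousOn_mul hE

/-- Grönwall for the difference of `y = e^{-δw} x` and `y' = e^{-δw'} x'`: path and state enter the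
field smoothly, and the rough `g` enters only through a factor smooth in the path. The constant
depends on the bound `M` alone, so one estimate serves for uniqueness and for continuity in path and
initial value. -/
theorem SolvesOn.exists_lipschitz (hf : ContDiff ℝ 1 (fun p : ℝ × ℝ => f p.1 p.2))
    (hg : LocallyIntegrable g) (δ : ℝ) {a b : ℝ} (hab : a ≤ b) (M : ℝ) :
    ∃ C, ∀ (w w' x x' : ℝ → ℝ) (x₀ x₀' η : ℝ),
      ContinuousOn w (Icc a b) → ContinuousOn w' (Icc a b) →
      SolvesOn (fun t x => f t x + g t) δ w a b x₀ x →
      SolvesOn (fun t x => f t x + g t) δ w' a b x₀' x' →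
      (∀ s ∈ Icc a b, |w s| ≤ M) → (∀ s ∈ Icc a b, |w' s| ≤ M) →
      (∀ s ∈ Icc a b, |x s| ≤ M) → (∀ s ∈ Icc a b, |x' s| ≤ M) →
      (∀ s ∈ Icc a b, |w s - w' s| ≤ η) → |x₀ - x₀'| ≤ η →
      ∀ t ∈ Icc a b, |x t - x' t| ≤ C * η := by
  -- `N` bounds the paths, the states and the conjugated states. It is also at least `1`, so that
  -- `L₁` at second argument `1` is a Lipschitz constant for `e^{-δp}`, the factor of `g`.
  set N := |M| * Real.exp (|δ| * |M|) + 1 with hN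
  obtain ⟨L, hL0, hL⟩ := exists_abs_sub_le_of_contDiff
    (Ψ := fun s p y => Real.exp (-δ * p) * f s (Real.exp (δ * p) * y))
    (ContDiff.mul (by fun_prop) (hf.comp (g := fun p : ℝ × ℝ => f p.1 p.2)
      (f := fun p : ℝ × ℝ × ℝ => (p.1, Real.exp (δ * p.2.1) * p.2.2)) (by fun_prop))) a b N
  obtain ⟨L₁, hL₁0, hL₁⟩ := exists_abs_sub_le_of_contDiff
    (Ψ := fun _ p y => Real.exp (-δ * p) * y) (by fun_prop) a b N
  obtain ⟨L₂, hL₂0, hL₂⟩ := exists_abs_sub_le_of_contDiff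
    (Ψ := fun _ p y => Real.exp (δ * p) * y) (by fun_prop) a b N
  -- The three terms account for the initial values, the path inside `f` and the path in front of
  -- `g`.
  set D := 2 * L₁ + L * (b - a) + L₁ * ∫ s in a..b, |g s| with hD
  refine ⟨L₂ * (1 + D * Real.exp (L * (b - a))), ?_⟩
  intro w w' x x' x₀ x₀' η hw hw' hx hx' bw bw' bx bx' hη hη₀
  have hη0 : 0 ≤ η := (abs_nonneg _).trans hη₀
  have hexp1 : 1 ≤ Real.exp (|δ| * |M|) := Real.one_le_exp (by positivity)
  have hMN : ∀ p, |p| ≤ M → |p| ≤ N := fun p hp => by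
    have : M ≤ |M| := le_abs_self M
    nlinarith [abs_nonneg M]
  have h1N : |(1 : ℝ)| ≤ N := by
    rw [abs_one, hN]
    have : 0 ≤ |M| * Real.exp (|δ| * |M|) := by positivity
    linarith
  have hyN : ∀ p z, |p| ≤ M → |z| ≤ M → |Real.exp (-δ * p) * z| ≤ N := fun p z hp hz => by
    rw [abs_mul, Real.abs_exp, mul_comm]
    have h1 : |z| ≤ |M| := hz.trans (le_abs_self M)
    have h2 : Real.exp (-δ * p) ≤ Real.exp (|δ| * |M|) := by
      rw [Real.exp_le_exp]
      calc -δ * p ≤ |-δ * p| := le_abs_self _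
        _ = |δ| * |p| := by rw [abs_mul, abs_neg]
        _ ≤ _ := mul_le_mul_of_nonneg_left (hp.trans (le_abs_self M)) (abs_nonneg _)
    have h3 := mul_le_mul h1 h2 (Real.exp_pos _).le (abs_nonneg _)
    linarith
  have hcancel : ∀ p z : ℝ, Real.exp (δ * p) * (Real.exp (-δ * p) * z) = z := fun p z => by
    rw [← mul_assoc, ← Real.exp_add]; simp
  set y := fun t => Real.exp (-δ * w t) * x t with hy
  set y' := fun t => Real.exp (-δ * w' t) * x' t with hy'
  have hyc : ContinuousOn y (Icc a b) := ((continuousOn_const.mul hw).rexp).mul hx.1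
  have hyc' : ContinuousOn y' (Icc a b) := ((continuousOn_const.mul hw').rexp).mul hx'.1
  have huc : ContinuousOn (fun t => |y t - y' t|) (Icc a b) := (hyc.sub hyc').abs
  have hi := intervalIntegrable_exp_mul_add (δ := δ) hf.continuous hg hw hx.1 hab
  have hi' := intervalIntegrable_exp_mul_add (δ := δ) hf.continuous hg hw' hx'.1 hab
  have hgi : ∀ c d, IntervalIntegrable (fun s => |g s|) volume c d :=
    fun c d => (hg.intervalIntegrable_of_real).abs
  have key : ∀ t ∈ Icc a b, |y t - y' t| ≤ D * η + L * ∫ s in a..t, |y s - y' s| := by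
    intro t ht
    have hsub : uIcc a t ⊆ uIcc a b := by
      rw [uIcc_of_le ht.1, uIcc_of_le hab]; exact Icc_subset_Icc_right ht.2
    have hui : IntervalIntegrable (fun s => |y s - y' s|) volume a t :=
      (huc.mono (by rw [← uIcc_of_le hab]; exact hsub)).intervalIntegrable
    have e : y t - y' t = (Real.exp (-δ * w a) * x₀ - Real.exp (-δ * w' a) * x₀') +
        ∫ s in a..t, (Real.exp (-δ * w s) * (f s (x s) + g s) -
          Real.exp (-δ * w' s) * (f s (x' s) + g s)) := by
      rw [intervalIntegral.integral_sub (hi.mono_set hsub) (hi'.mono_set hsub), hy, hy']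
      simp only
      rw [hx.2 t ht, hx'.2 t ht]
      ring
    have haI : a ∈ Icc a b := ⟨le_rfl, hab⟩
    have hx₀ : |x₀| ≤ M := by rw [← hx.initial hab]; exact bx a haI
    have hx₀' : |x₀'| ≤ M := by rw [← hx'.initial hab]; exact bx' a haI
    have b1 : |Real.exp (-δ * w a) * x₀ - Real.exp (-δ * w' a) * x₀'| ≤ L₁ * (2 * η) :=
      (hL₁ a haI _ _ _ _ (hMN _ (bw a haI)) (hMN _ (bw' a haI)) (hMN _ hx₀)
        (hMN _ hx₀')).trans (mul_le_mul_of_nonneg_left (by linarith [hη a haI]) hL₁0)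
    have b2 : |∫ s in a..t, (Real.exp (-δ * w s) * (f s (x s) + g s) -
          Real.exp (-δ * w' s) * (f s (x' s) + g s))| ≤
        ∫ s in a..t, ((L * η + L * |y s - y' s|) + L₁ * η * |g s|) := by
      have hbi : IntervalIntegrable (fun s => (L * η + L * |y s - y' s|) + L₁ * η * |g s|)
          volume a t :=
        (intervalIntegrable_const.add (hui.const_mul L)).add ((hgi a t).const_mul _)
      rw [← Real.norm_eq_abs]
      refine intervalIntegral.norm_integral_le_of_norm_le ht.1 ?_ hbi
      refine ae_of_all _ fun s hs => ?_
      have hs' : s ∈ Icc a b := ⟨hs.1.le, hs.2.trans ht.2⟩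
      have c1 := hL s hs' _ _ _ _ (hMN _ (bw s hs')) (hMN _ (bw' s hs'))
        (hyN _ _ (bw s hs') (bx s hs')) (hyN _ _ (bw' s hs') (bx' s hs'))
      simp only [hcancel] at c1
      have c2 := hL₁ s hs' _ _ _ _ (hMN _ (bw s hs')) (hMN _ (bw' s hs')) h1N h1N
      simp only [mul_one, sub_self, abs_zero, add_zero] at c2
      have c3 : |(Real.exp (-δ * w s) - Real.exp (-δ * w' s)) * g s| ≤ L₁ * η * |g s| := by
        rw [abs_mul]
        exact mul_le_mul_of_nonneg_right
          (c2.trans (mul_le_mul_of_nonneg_left (hη s hs') hL₁0)) (abs_nonneg _)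
      have c4 := mul_le_mul_of_nonneg_left (hη s hs') hL0
      rw [Real.norm_eq_abs]
      calc _ = |(Real.exp (-δ * w s) * f s (x s) - Real.exp (-δ * w' s) * f s (x' s)) +
            (Real.exp (-δ * w s) - Real.exp (-δ * w' s)) * g s| := by congr 1; ring
        _ ≤ _ := abs_add_le _ _
        _ ≤ _ := by
          have : |y s - y' s| = |Real.exp (-δ * w s) * x s - Real.exp (-δ * w' s) * x' s| := rfl
          rw [this]
          linarith
    rw [intervalIntegral.integral_add (intervalIntegrable_const.add (hui.const_mul L))
      ((hgi a t).const_mul _), intervalIntegral.integral_add intervalIntegrable_const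
      (hui.const_mul L), intervalIntegral.integral_const, intervalIntegral.integral_const_mul,
      intervalIntegral.integral_const_mul, smul_eq_mul] at b2
    have b3 : ∫ s in a..t, |g s| ≤ ∫ s in a..b, |g s| :=
      intervalIntegral.integral_mono_interval le_rfl ht.1 ht.2
        (ae_of_all _ fun _ => abs_nonneg _) (hgi a b)
    have b4 := mul_le_mul_of_nonneg_left b3 (mul_nonneg hL₁0 hη0)
    have b5 : (t - a) * (L * η) ≤ (b - a) * (L * η) :=
      mul_le_mul_of_nonneg_right (by linarith [ht.2]) (mul_nonneg hL0 hη0)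
    rw [e]
    refine (abs_add_le _ _).trans ?_
    rw [hD]
    linarith
  have fin := le_mul_exp_of_le_add_mul_integral hab huc hL0 key
  have hD0 : 0 ≤ D := by
    have : 0 ≤ ∫ s in a..b, |g s| :=
      intervalIntegral.integral_nonneg hab fun _ _ => abs_nonneg _
    have : 0 ≤ b - a := sub_nonneg.2 hab
    positivity
  intro t ht
  have d1 := fin t ht
  have d2 := hL₂ t ht _ _ _ _ (hMN _ (bw t ht)) (hMN _ (bw' t ht))
    (hyN _ _ (bw t ht) (bx t ht)) (hyN _ _ (bw' t ht) (bx' t ht))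
  simp only [hcancel] at d2
  have d3 : D * η * Real.exp (L * (t - a)) ≤ D * η * Real.exp (L * (b - a)) :=
    mul_le_mul_of_nonneg_left (Real.exp_le_exp.2
      (mul_le_mul_of_nonneg_left (by linarith [ht.2]) hL0)) (mul_nonneg hD0 hη0)
  refine d2.trans ?_
  rw [mul_assoc]
  refine mul_le_mul_of_nonneg_left ?_ hL₂0
  have d4 := hη t ht
  have : |y t - y' t| = |Real.exp (-δ * w t) * x t - Real.exp (-δ * w' t) * x' t| := rfl
  rw [← this]
  linarith

theorem SolvesOn.eqOn (hf : ContDiff ℝ 1 (fun p : ℝ × ℝ => f p.1 p.2))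
    (hg : LocallyIntegrable g) {a b x₀ : ℝ} {w x x' : ℝ → ℝ} (hw : ContinuousOn w (Icc a b))
    (hx : SolvesOn (fun t x => f t x + g t) δ w a b x₀ x)
    (hx' : SolvesOn (fun t x => f t x + g t) δ w a b x₀ x') : EqOn x x' (Icc a b) := by
  intro t ht
  obtain ⟨M₁, h₁⟩ := isCompact_Icc.exists_bound_of_continuousOn hw
  obtain ⟨M₂, h₂⟩ := isCompact_Icc.exists_bound_of_continuousOn hx.1
  obtain ⟨M₃, h₃⟩ := isCompact_Icc.exists_bound_of_continuousOn hx'.1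
  obtain ⟨C, hC⟩ := SolvesOn.exists_lipschitz hf hg δ (ht.1.trans ht.2) (max M₁ (max M₂ M₃))
  have b₁ : ∀ s ∈ Icc a b, |w s| ≤ max M₁ (max M₂ M₃) := fun s hs =>
    (h₁ s hs).trans (le_max_left _ _)
  have := hC w w x x' x₀ x₀ 0 hw hw hx hx' b₁ b₁
    (fun s hs => (h₂ s hs).trans ((le_max_left _ _).trans (le_max_right _ _)))
    (fun s hs => (h₃ s hs).trans ((le_max_right _ _).trans (le_max_right _ _)))
    (by simp) (by simp) t ht
  rw [mul_zero] at this
  linarith [abs_nonpos_iff.1 this]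

/-- Backward uniqueness: solutions that meet at the final time coincide. -/
theorem SolvesOn.eqOn_of_final_eq (hf : ContDiff ℝ 1 (fun p : ℝ × ℝ => f p.1 p.2))
    (hg : LocallyIntegrable g) {a b x₀ x₀' : ℝ} {w x x' : ℝ → ℝ} (hw : ContinuousOn w (Icc a b))
    (hx : SolvesOn (fun t x => f t x + g t) δ w a b x₀ x)
    (hx' : SolvesOn (fun t x => f t x + g t) δ w a b x₀' x') (hb : x b = x' b) :
    EqOn x x' (Icc a b) := by
  intro t ht
  have hab := ht.1.trans ht.2
  set y := fun t => Real.exp (-δ * w t) * x t with hy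
  set y' := fun t => Real.exp (-δ * w t) * x' t with hy'
  have hyc : ContinuousOn y (Icc a b) := ((continuousOn_const.mul hw).rexp).mul hx.1
  have hyc' : ContinuousOn y' (Icc a b) := ((continuousOn_const.mul hw).rexp).mul hx'.1
  have huc : ContinuousOn (fun t => |y t - y' t|) (Icc a b) := (hyc.sub hyc').abs
  obtain ⟨M₁, h₁⟩ := isCompact_Icc.exists_bound_of_continuousOn hw
  obtain ⟨M₂, h₂⟩ := isCompact_Icc.exists_bound_of_continuousOn hyc
  obtain ⟨M₃, h₃⟩ := isCompact_Icc.exists_bound_of_continuousOn hyc'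
  obtain ⟨L, hL0, hL⟩ := exists_abs_sub_le_of_contDiff
    (Ψ := fun s p y => Real.exp (-δ * p) * f s (Real.exp (δ * p) * y))
    (ContDiff.mul (by fun_prop) (hf.comp (g := fun p : ℝ × ℝ => f p.1 p.2)
      (f := fun p : ℝ × ℝ × ℝ => (p.1, Real.exp (δ * p.2.1) * p.2.2)) (by fun_prop))) a b
      (max M₁ (max M₂ M₃))
  have hcancel : ∀ p z : ℝ, Real.exp (δ * p) * (Real.exp (-δ * p) * z) = z := fun p z => by
    rw [← mul_assoc, ← Real.exp_add]; simp
  have hi := intervalIntegrable_exp_mul_add (δ := δ) hf.continuous hg hw hx.1 hab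
  have hi' := intervalIntegrable_exp_mul_add (δ := δ) hf.continuous hg hw hx'.1 hab
  have key : ∀ t ∈ Icc a b, |y t - y' t| ≤ L * ∫ s in t..b, |y s - y' s| := by
    intro t ht
    have hsub : uIcc t b ⊆ uIcc a b := by
      rw [uIcc_of_le ht.2, uIcc_of_le hab]; exact Icc_subset_Icc_left ht.1
    have hui : IntervalIntegrable (fun s => |y s - y' s|) volume t b :=
      (huc.mono (by rw [← uIcc_of_le hab]; exact hsub)).intervalIntegrable
    have e : y t - y' t = -∫ s in t..b, (Real.exp (-δ * w s) * (f s (x s) + g s) -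
          Real.exp (-δ * w s) * (f s (x' s) + g s)) := by
      rw [intervalIntegral.integral_sub (hi.mono_set hsub) (hi'.mono_set hsub),
        ← hx.sub_eq_integral hi ht.1 ht.2 le_rfl, ← hx'.sub_eq_integral hi' ht.1 ht.2 le_rfl, hb]
      simp only [hy, hy']
      ring
    rw [e, abs_neg, ← intervalIntegral.integral_const_mul, ← Real.norm_eq_abs]
    refine intervalIntegral.norm_integral_le_of_norm_le ht.2 ?_ (hui.const_mul L)
    refine ae_of_all _ fun s hs => ?_
    have hs' : s ∈ Icc a b := ⟨ht.1.trans hs.1.le, hs.2⟩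
    have c1 := hL s hs' (w s) (w s) (y s) (y' s) ((h₁ s hs').trans (le_max_left _ _))
      ((h₁ s hs').trans (le_max_left _ _))
      ((h₂ s hs').trans ((le_max_left _ _).trans (le_max_right _ _)))
      ((h₃ s hs').trans ((le_max_right _ _).trans (le_max_right _ _)))
    simp only [hy, hy', hcancel, sub_self, abs_zero, zero_add] at c1
    rw [Real.norm_eq_abs]
    refine le_trans (le_of_eq ?_) c1
    congr 1
    ring
  -- Time reversal turns the estimate from the final time into the forward Grönwall inequality with
  -- `ε = 0`.
  have hrev : ContinuousOn (fun t => |y (-t) - y' (-t)|) (Icc (-b) (-a)) :=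
    huc.comp continuousOn_neg fun s hs => ⟨by linarith [hs.2], by linarith [hs.1]⟩
  have := le_mul_exp_of_le_add_mul_integral (ε := 0) (neg_le_neg hab) hrev hL0
    (fun s hs => by
      have h1 := key (-s) ⟨by linarith [hs.2], by linarith [hs.1]⟩
      rw [intervalIntegral.integral_comp_neg (fun s => |y s - y' s|), neg_neg]
      linarith) (-t) ⟨by linarith [ht.2], by linarith [ht.1]⟩
  rw [zero_mul, neg_neg] at this
  have h0 := sub_eq_zero.1 (abs_nonpos_iff.1 this)
  exact mul_left_cancel₀ (Real.exp_pos _).ne' h0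

end Coefficients

/-! ### Existence of pathwise solutions -/

section Existence

variable {f : ℝ → ℝ → ℝ} {g h : ℝ → ℝ} {δ ν : ℝ}

theorem le_of_dissipative (hdiss : ∀ t x, f t x * x ≤ -ν * x ^ 2 + h t * |x|) (s : ℝ) {y : ℝ}
    (hy : 0 < y) : f s y + g s ≤ -ν * y + (|g s| + |h s|) := by
  have h1 := hdiss s y
  rw [abs_of_pos hy] at h1
  have h2 : f s y ≤ -ν * y + h s := by
    refine le_of_mul_le_mul_right ?_ hy
    linarith
  linarith [le_abs_self (g s), le_abs_self (h s)]

theorem ge_of_dissipative (hdiss : ∀ t x, f t x * x ≤ -ν * x ^ 2 + h t * |x|) (s : ℝ) {y : ℝ}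
    (hy : y < 0) : -ν * y - (|g s| + |h s|) ≤ f s y + g s := by
  have h1 := hdiss s y
  rw [abs_of_neg hy] at h1
  have h2 : -f s y ≤ ν * y + h s := by
    refine le_of_mul_le_mul_right ?_ (neg_pos.2 hy)
    linarith
  linarith [neg_abs_le (g s), le_abs_self (h s)]

theorem intervalIntegrable_exp_mul {w q : ℝ → ℝ} (hw : Continuous w) (hq : LocallyIntegrable q)
    (a b : ℝ) : IntervalIntegrable (fun s => Real.exp (-δ * w s) * q s) volume a b :=
  hq.intervalIntegrable_of_real.continuousOn_mul (by fun_prop)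

/-- The a priori bound without damping. It uses only the sign of the state, so it survives
truncation of the nonlinearity. -/
theorem SolvesOn.exp_mul_abs_le_add_integral {F : ℝ → ℝ → ℝ} {w x q : ℝ → ℝ} {a b x₀ : ℝ}
    (hx : SolvesOn F δ w a b x₀ x) (hw : Continuous w)
    (hF : IntervalIntegrable (fun s => Real.exp (-δ * w s) * F s (x s)) volume a b)
    (hq : LocallyIntegrable q) (hq0 : ∀ s, 0 ≤ q s) (hF₁ : ∀ s y, 0 < y → F s y ≤ q s)
    (hF₂ : ∀ s y, y < 0 → -q s ≤ F s y) :
    ∀ t ∈ Icc a b, Real.exp (-δ * w t) * |x t| ≤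
      Real.exp (-δ * w a) * |x₀| + ∫ s in a..t, Real.exp (-δ * w s) * q s := by
  have hqi := fun c d => intervalIntegrable_exp_mul (δ := δ) hw hq c d
  refine hx.exp_mul_abs_le (ν := 0) hw.continuousOn hF (hqi a b) le_rfl
    (fun s y hy => by simpa using hF₁ s y hy) (fun s y hy => by simpa using hF₂ s y hy)
    (continuous_const.add (intervalIntegral.continuous_primitive hqi a)).continuousOn
    (fun t ht => ?_) (by simp) (fun s t has hst htb => ?_)
  · have := intervalIntegral.integral_nonneg (μ := volume) (f := fun s => Real.exp (-δ * w s) * q s) ht.1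
      fun s _ => mul_nonneg (Real.exp_pos _).le (hq0 s)
    have := mul_nonneg (Real.exp_pos (-δ * w a)).le (abs_nonneg x₀)
    linarith
  · simp only [neg_zero, zero_mul, zero_add]
    rw [← intervalIntegral.integral_add_adjacent_intervals (hqi a s) (hqi s t)]
    ring

/-- Subtracting the primitive `G` of `e^{-δw} g` leaves a continuous field; clamping the state makes
it bounded and globally Lipschitz in the unknown, so Picard-Lindelöf covers all of `[a, b]`. The a
priori bound then shows that the clamp is never active. -/
theorem exists_solvesOn (hf : ContDiff ℝ 1 (fun p : ℝ × ℝ => f p.1 p.2))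
    (hg : LocallyIntegrable g) (hh : LocallyIntegrable h) (hν : 0 ≤ ν)
    (hdiss : ∀ t x, f t x * x ≤ -ν * x ^ 2 + h t * |x|) {w : ℝ → ℝ} (hw : Continuous w)
    {a b : ℝ} (hab : a ≤ b) (x₀ : ℝ) : ∃ x, SolvesOn (fun t x => f t x + g t) δ w a b x₀ x := by
  set q : ℝ → ℝ := fun s => |g s| + |h s| with hq
  have hq0 : ∀ s, 0 ≤ q s := fun s => by positivity
  have hqL : LocallyIntegrable q := by
    refine LocallyIntegrable.add (fun t => ?_) (fun t => ?_)
    · exact (hg t).norm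
    · exact (hh t).norm
  have hqi := fun c d => intervalIntegrable_exp_mul (δ := δ) hw hqL c d
  have hgi := fun c d => intervalIntegrable_exp_mul (δ := δ) hw hg c d
  set G : ℝ → ℝ := fun t => ∫ s in a..t, Real.exp (-δ * w s) * g s with hG
  have hGc : Continuous G := intervalIntegral.continuous_primitive hgi a
  obtain ⟨M, hM⟩ := isCompact_Icc.exists_bound_of_continuousOn (s := Icc a b)
    (f := fun t => Real.exp (δ * w t)) (by fun_prop)
  obtain ⟨M₁, hM₁⟩ := isCompact_Icc.exists_bound_of_continuousOn (s := Icc a b)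
    (f := fun t => Real.exp (-δ * w t)) (by fun_prop)
  have haI : a ∈ Icc a b := ⟨le_rfl, hab⟩
  have hM0 : 0 ≤ M := (norm_nonneg _).trans (hM a haI)
  have hM₁0 : 0 ≤ M₁ := (norm_nonneg _).trans (hM₁ a haI)
  set B := Real.exp (-δ * w a) * |x₀| + ∫ s in a..b, Real.exp (-δ * w s) * q s with hB
  have hB0 : 0 ≤ B := by
    have := intervalIntegral.integral_nonneg (μ := volume) (f := fun s => Real.exp (-δ * w s) * q s) hab
      fun s _ => mul_nonneg (Real.exp_pos _).le (hq0 s)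
    have := mul_nonneg (Real.exp_pos (-δ * w a)).le (abs_nonneg x₀)
    linarith
  -- `M * B` is the a priori bound for the state. The summand `1` makes `R` positive, so that
  -- clamping to `[-R, R]` preserves strict signs and with them the dissipativity.
  set R := M * B + 1 with hR
  have hR0 : 0 < R := by positivity
  set cl : ℝ → ℝ := fun y => max (-R) (min R y) with hcl
  have hclc : Continuous cl := by fun_prop
  have hclR : ∀ y, |cl y| ≤ R := fun y =>
    abs_le.2 ⟨le_max_left _ _, max_le (by linarith) (min_le_left _ _)⟩
  have hcld : ∀ y y', |cl y - cl y'| ≤ |y - y'| := fun y y' => by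
    refine (abs_max_sub_max_le_max (-R) (min R y) (-R) (min R y')).trans ?_
    rw [sub_self, abs_zero, max_eq_right (abs_nonneg _)]
    refine (abs_min_sub_min_le_max R y R y').trans ?_
    rw [sub_self, abs_zero, max_eq_right (abs_nonneg _)]
  have hcle : ∀ y, |y| ≤ R → cl y = y := fun y hy => by
    rw [abs_le] at hy
    simp only [hcl, min_eq_right hy.2, max_eq_right hy.1]
  have hcancel : ∀ p z : ℝ, Real.exp (-δ * p) * (Real.exp (δ * p) * z) = z := fun p z => by
    rw [← mul_assoc, ← Real.exp_add]; simp
  obtain ⟨Mf, hMf⟩ := (isCompact_Icc.prod isCompact_Icc).exists_bound_of_continuousOn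
    (s := Icc a b ×ˢ Icc (-R) R) (f := fun p : ℝ × ℝ => f p.1 p.2) hf.continuous.continuousOn
  obtain ⟨Lf, hLf0, hLf⟩ := exists_abs_sub_le_of_contDiff (Ψ := fun s _ y => f s y)
    (hf.comp (g := fun p : ℝ × ℝ => f p.1 p.2)
      (f := fun p : ℝ × ℝ × ℝ => (p.1, p.2.2)) (by fun_prop)) a b R
  have hMf0 : 0 ≤ Mf := (norm_nonneg _).trans (hMf (a, 0) ⟨haI, by simp [hR0.le]⟩)
  -- The field for `z = e^{-δw} x - G`.
  set V : ℝ → ℝ → ℝ := fun t z =>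
    Real.exp (-δ * w t) * f t (cl (Real.exp (δ * w t) * (z + G t))) with hV
  have hVc : Continuous (fun p : ℝ × ℝ => V p.1 p.2) := by
    have : Continuous (fun p : ℝ × ℝ =>
        f p.1 (cl (Real.exp (δ * w p.1) * (p.2 + G p.1)))) :=
      hf.continuous.comp (g := fun p : ℝ × ℝ => f p.1 p.2)
        (f := fun p : ℝ × ℝ => (p.1, cl (Real.exp (δ * w p.1) * (p.2 + G p.1)))) (by fun_prop)
    simp only [hV]
    fun_prop
  -- The radius of the ball is the bound of the field times the length of the interval, so the
  -- solution cannot leave it before time `b`.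
  have hPL : IsPicardLindelof V (⟨a, haI⟩ : Icc a b) (Real.exp (-δ * w a) * x₀)
      ((M₁ * Mf).toNNReal * (b - a).toNNReal) 0 (M₁ * Mf).toNNReal
      (M₁ * (Lf * M)).toNNReal := by
    refine ⟨fun t ht => ?_, fun z _ => ?_, fun t ht z _ => ?_, ?_⟩
    · refine LipschitzOnWith.of_dist_le_mul fun z _ z' _ => ?_
      rw [Real.coe_toNNReal _ (by positivity)]
      simp only [Real.dist_eq, hV]
      rw [← mul_sub, abs_mul, mul_assoc M₁]
      refine mul_le_mul (hM₁ t ht) ?_ (abs_nonneg _) hM₁0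
      have h1 := hLf t ht 0 0 (cl (Real.exp (δ * w t) * (z + G t)))
        (cl (Real.exp (δ * w t) * (z' + G t))) (by simp [hR0.le]) (by simp [hR0.le])
        (hclR _) (hclR _)
      rw [sub_self, abs_zero, zero_add] at h1
      refine h1.trans ?_
      rw [mul_assoc]
      refine mul_le_mul_of_nonneg_left ((hcld _ _).trans ?_) hLf0
      rw [← mul_sub, add_sub_add_right_eq_sub, abs_mul]
      exact mul_le_mul_of_nonneg_right (hM t ht) (abs_nonneg _)
    · exact (hVc.comp (f := fun t : ℝ => (t, z)) (by fun_prop)).continuousOn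
    · rw [Real.coe_toNNReal _ (by positivity)]
      simp only [hV, norm_mul]
      exact mul_le_mul (hM₁ t ht) (hMf (t, _) ⟨ht, abs_le.1 (hclR _)⟩) (norm_nonneg _) hM₁0
    · rw [NNReal.coe_mul, Real.coe_toNNReal _ (sub_nonneg.2 hab)]
      simp [sub_nonneg.2 hab]
  obtain ⟨z, hz0, hz⟩ := hPL.exists_eq_forall_mem_Icc_hasDerivWithinAt
    (x := Real.exp (-δ * w a) * x₀) (by simp)
  have hzc : ContinuousOn z (Icc a b) := fun t ht => (hz t ht).continuousWithinAt
  have hVz : ContinuousOn (fun s => V s (z s)) (Icc a b) :=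
    hVc.comp_continuousOn (continuousOn_id.prodMk hzc)
  have hzeq : ∀ t ∈ Icc a b, z t = Real.exp (-δ * w a) * x₀ + ∫ s in a..t, V s (z s) := by
    intro t ht
    have hsub : Icc a t ⊆ Icc a b := Icc_subset_Icc_right ht.2
    rw [intervalIntegral.integral_eq_sub_of_hasDeriv_right_of_le ht.1 (hzc.mono hsub)
      (fun s hs => ((hz s (hsub (Ioo_subset_Icc_self hs))).hasDerivAt
        (Icc_mem_nhds hs.1 (hs.2.trans_le ht.2))).hasDerivWithinAt)
      ((hVz.mono (by rw [uIcc_of_le ht.1]; exact hsub)).intervalIntegrable), ← hz0]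
    simp
  set x : ℝ → ℝ := fun t => Real.exp (δ * w t) * (z t + G t) with hx
  have hxc : ContinuousOn x (Icc a b) :=
    ((continuous_const.mul hw).rexp.continuousOn).mul (hzc.add hGc.continuousOn)
  have hsol : SolvesOn (fun t y => f t (cl y) + g t) δ w a b x₀ x := by
    refine ⟨hxc, fun t ht => ?_⟩
    have hsub : uIcc a t ⊆ Icc a b := by rw [uIcc_of_le ht.1]; exact Icc_subset_Icc_right ht.2
    simp only [hx, hcancel, mul_add]
    rw [intervalIntegral.integral_add ((hVz.mono hsub).intervalIntegrable.congr ?_) (hgi a t),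
      hzeq t ht]
    · simp only [hV, hG, mul_add]
      ring
    · exact fun s _ => by simp only [hV, mul_add]
  have hfc : Continuous (fun p : ℝ × ℝ => f p.1 (cl p.2)) :=
    hf.continuous.comp (g := fun p : ℝ × ℝ => f p.1 p.2)
      (f := fun p : ℝ × ℝ => (p.1, cl p.2)) (by fun_prop)
  have hbd := hsol.exp_mul_abs_le_add_integral hw
    (intervalIntegrable_exp_mul_add (f := fun s y => f s (cl y)) hfc hg hw.continuousOn hxc hab)
    hqL hq0
    (fun s y hy => by
      have hc : 0 < cl y := lt_max_of_lt_right (lt_min hR0 hy)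
      have := le_of_dissipative (g := g) hdiss s hc
      nlinarith)
    (fun s y hy => by
      have hc : cl y < 0 := max_lt (by linarith) (min_lt_of_right_lt hy)
      have := ge_of_dissipative (g := g) hdiss s hc
      nlinarith)
  have hxR : ∀ t ∈ Icc a b, |x t| ≤ R := by
    intro t ht
    have h1 := hbd t ht
    have h2 : ∫ s in a..t, Real.exp (-δ * w s) * q s ≤ ∫ s in a..b, Real.exp (-δ * w s) * q s :=
      intervalIntegral.integral_mono_interval le_rfl ht.1 ht.2
        (ae_of_all _ fun s => mul_nonneg (Real.exp_pos _).le (hq0 s)) (hqi a b)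
    have h3 : Real.exp (-δ * w t) * |x t| ≤ B := by linarith
    have h4 : |x t| = Real.exp (δ * w t) * (Real.exp (-δ * w t) * |x t|) := by
      rw [← mul_assoc, ← Real.exp_add]; simp
    rw [h4, hR]
    have h5 : Real.exp (δ * w t) ≤ M := (le_abs_self _).trans (hM t ht)
    have := mul_le_mul h5 h3 (by positivity) hM0
    linarith
  refine ⟨x, hxc, fun t ht => (hsol.2 t ht).trans ?_⟩
  congr 1
  refine intervalIntegral.integral_congr fun s hs => ?_
  rw [uIcc_of_le ht.1] at hs
  simp only [hcle _ (hxR s ⟨hs.1, hs.2.trans ht.2⟩)]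

theorem exists_isPathwiseSolution (hf : ContDiff ℝ 1 (fun p : ℝ × ℝ => f p.1 p.2))
    (hg : LocallyIntegrable g) (hh : LocallyIntegrable h) (hν : 0 ≤ ν)
    (hdiss : ∀ t x, f t x * x ≤ -ν * x ^ 2 + h t * |x|) {w : ℝ → ℝ} (hw : Continuous w)
    (τ x₀ : ℝ) : ∃ x, IsPathwiseSolution (fun t x => f t x + g t) δ w τ x₀ x := by
  have hex : ∀ b, ∃ x, τ ≤ b → SolvesOn (fun t x => f t x + g t) δ w τ b x₀ x := fun b => by
    by_cases hb : τ ≤ b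
    · obtain ⟨x, hx⟩ := exists_solvesOn (δ := δ) hf hg hh hν hdiss hw hb x₀
      exact ⟨x, fun _ => hx⟩
    · exact ⟨0, fun h => absurd h hb⟩
  choose X hX using hex
  have hcons : ∀ b, τ ≤ b → EqOn (fun t => X t t) (X b) (Icc τ b) := fun b hb t ht =>
    ((hX t ht.1).eqOn hf hg hw.continuousOn ((hX b hb).mono ht.2)) ⟨ht.1, le_rfl⟩
  -- The solutions on `[τ, b]` agree on overlaps by uniqueness, so the diagonal is a solution on the
  -- half-line.
  refine ⟨fun t => X t t, fun t ht => ?_, fun t ht => ?_⟩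
  · have ht' : τ ≤ t + 1 := le_add_of_le_of_nonneg ht zero_le_one
    have h1 : ContinuousOn (fun t => X t t) (Icc τ (t + 1)) := (hX _ ht').1.congr (hcons _ ht')
    refine (h1 t ⟨ht, by linarith⟩).mono_of_mem_nhdsWithin ?_
    exact mem_nhdsWithin.2 ⟨Iio (t + 1), isOpen_Iio, by simp, fun s hs => ⟨hs.2, hs.1.le⟩⟩
  · refine ((hX t ht).2 t ⟨ht, le_rfl⟩).trans ?_
    congr 1
    refine intervalIntegral.integral_congr fun s hs => ?_
    rw [uIcc_of_le ht] at hs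
    simp only [hcons t ht hs]

end Existence

/-! ### Measurability through evaluations -/

/-- The Borel sets of the separable space `C(K, ℝ)` are generated by evaluations: a closed ball is
described by countably many points of `K`, and an open set is a countable union of closed balls. The
σ-algebra on `Ω` is arbitrary, so that the lemma can give adaptedness. -/
theorem measurable_comp_of_continuous_of_measurable_eval {Ω K : Type*} {mΩ : MeasurableSpace Ω}
    [TopologicalSpace K] [CompactSpace K] [SecondCountableTopology K] [T2Space K] [Nonempty K]
    {S : C(K, ℝ) → ℝ} (hS : Continuous S) {G : Ω → C(K, ℝ)}
    (hG : ∀ s, Measurable fun ω => G ω s) : Measurable fun ω => S (G ω) := by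
  have hball : ∀ (v : C(K, ℝ)) (r : ℝ), 0 ≤ r → MeasurableSet {ω | dist (G ω) v ≤ r} := by
    intro v r hr
    have e : {ω | dist (G ω) v ≤ r} =
        ⋂ n, {ω | dist (G ω (TopologicalSpace.denseSeq K n)) (v (TopologicalSpace.denseSeq K n)) ≤ r} := by
      ext ω
      simp only [mem_ofPred_eq, mem_iInter]
      rw [ContinuousMap.dist_le hr]
      refine ⟨fun h n => h _, fun h s => ?_⟩
      have hcl : IsClosed {s | dist (G ω s) (v s) ≤ r} :=
        isClosed_le (by fun_prop) continuous_const
      have := (TopologicalSpace.denseRange_denseSeq K).induction_on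
        (p := fun s => dist (G ω s) (v s) ≤ r) s hcl h
      exact this
    rw [e]
    exact MeasurableSet.iInter fun n => measurableSet_le ((hG _).dist measurable_const)
      measurable_const
  have hopen : ∀ U : Set C(K, ℝ), IsOpen U → MeasurableSet (G ⁻¹' U) := by
    intro U hU
    have e : G ⁻¹' U = ⋃ n : ℕ, ⋃ k : ℕ,
        {ω | Metric.closedBall (TopologicalSpace.denseSeq C(K, ℝ) n) (1 / ((k : ℝ) + 1)) ⊆ U ∧
          dist (G ω) (TopologicalSpace.denseSeq C(K, ℝ) n) ≤ 1 / ((k : ℝ) + 1)} := by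
      ext ω
      simp only [mem_preimage, mem_iUnion, mem_ofPred_eq]
      constructor
      · intro hω
        obtain ⟨ε, hε, hεU⟩ := Metric.isOpen_iff.1 hU _ hω
        obtain ⟨k, hk⟩ := exists_nat_one_div_lt (half_pos hε)
        obtain ⟨n, hn⟩ := (TopologicalSpace.denseRange_denseSeq C(K, ℝ)).exists_dist_lt (G ω)
          (ε := 1 / ((k : ℝ) + 1)) (by positivity)
        refine ⟨n, k, fun v hv => hεU ?_, hn.le⟩
        rw [Metric.mem_closedBall] at hv
        rw [Metric.mem_ball]
        have := dist_triangle_right v (G ω) (TopologicalSpace.denseSeq C(K, ℝ) n)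
        linarith
      · rintro ⟨n, k, hsub, hd⟩
        exact hsub (Metric.mem_closedBall.2 hd)
    rw [e]
    exact MeasurableSet.iUnion fun n => MeasurableSet.iUnion fun k =>
      (MeasurableSet.const _).inter (hball _ _ (by positivity))
  refine measurable_of_isOpen fun V hV => ?_
  exact hopen _ (hV.preimage hS)

/-! ### The solution map -/

section SolutionMap

variable {f : ℝ → ℝ → ℝ} {g h : ℝ → ℝ} {δ ν : ℝ} {X : (ℝ → ℝ) → ℝ → ℝ → ℝ → ℝ}

theorem solution_congr_path (hf : ContDiff ℝ 1 (fun p : ℝ × ℝ => f p.1 p.2))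
    (hg : LocallyIntegrable g)
    (hX : ∀ w, Continuous w → ∀ τ x₀,
      IsPathwiseSolution (fun t x => f t x + g t) δ w τ x₀ (X w τ x₀))
    {w w' : ℝ → ℝ} (hw : Continuous w) (hw' : Continuous w') {τ t c : ℝ} (ht : τ ≤ t)
    (hc : ∀ s ∈ Icc τ t, w' s = w s + c) (x₀ : ℝ) : X w' τ x₀ t = X w τ x₀ t :=
  (((hX w' hw' τ x₀).solvesOn t).eqOn hf hg hw'.continuousOn
    (((hX w hw τ x₀).solvesOn t).congr_path hc)) ⟨ht, le_rfl⟩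

theorem solution_eq (hf : ContDiff ℝ 1 (fun p : ℝ × ℝ => f p.1 p.2))
    (hg : LocallyIntegrable g)
    (hX : ∀ w, Continuous w → ∀ τ x₀,
      IsPathwiseSolution (fun t x => f t x + g t) δ w τ x₀ (X w τ x₀))
    {w : ℝ → ℝ} (hw : Continuous w) {τ t x₀ : ℝ} (ht : τ ≤ t) {x : ℝ → ℝ}
    (hx : IsPathwiseSolution (fun t x => f t x + g t) δ w τ x₀ x) : x t = X w τ x₀ t :=
  ((hx.solvesOn t).eqOn hf hg hw.continuousOn ((hX w hw τ x₀).solvesOn t)) ⟨ht, le_rfl⟩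

theorem solution_initial
    (hX : ∀ w, Continuous w → ∀ τ x₀,
      IsPathwiseSolution (fun t x => f t x + g t) δ w τ x₀ (X w τ x₀))
    {w : ℝ → ℝ} (hw : Continuous w) (τ x₀ : ℝ) : X w τ x₀ τ = x₀ :=
  ((hX w hw τ x₀).solvesOn τ).initial le_rfl

theorem solution_restart (hf : ContDiff ℝ 1 (fun p : ℝ × ℝ => f p.1 p.2))
    (hg : LocallyIntegrable g)
    (hX : ∀ w, Continuous w → ∀ τ x₀,
      IsPathwiseSolution (fun t x => f t x + g t) δ w τ x₀ (X w τ x₀))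
    {w : ℝ → ℝ} (hw : Continuous w) {τ s t : ℝ} (hs : τ ≤ s) (ht : s ≤ t) (x₀ : ℝ) :
    X w s (X w τ x₀ s) t = X w τ x₀ t := by
  have h1 := (hX w hw τ x₀).solvesOn t
  exact (((hX w hw s _).solvesOn t).eqOn hf hg hw.continuousOn (h1.restart
    (intervalIntegrable_exp_mul_add hf.continuous hg hw.continuousOn h1.1 (hs.trans ht)) hs))
    ⟨ht, le_rfl⟩

theorem strictMono_solution (hf : ContDiff ℝ 1 (fun p : ℝ × ℝ => f p.1 p.2))
    (hg : LocallyIntegrable g)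
    (hX : ∀ w, Continuous w → ∀ τ x₀,
      IsPathwiseSolution (fun t x => f t x + g t) δ w τ x₀ (X w τ x₀))
    {w : ℝ → ℝ} (hw : Continuous w) {τ t : ℝ} (ht : τ ≤ t) :
    StrictMono fun x₀ => X w τ x₀ t := by
  -- If the order were not kept, the two solutions would meet by the intermediate value theorem, and
  -- backward uniqueness would force equal initial values.
  intro x₁ x₂ hlt
  by_contra! hle
  have h₁ := (hX w hw τ x₁).solvesOn t
  have h₂ := (hX w hw τ x₂).solvesOn t
  have hivt := intermediate_value_Icc' ht (h₂.1.sub h₁.1)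
  obtain ⟨s, hs, hs0⟩ := hivt (show (0 : ℝ) ∈ _ from ⟨by simpa using hle, by
    simp only [Pi.sub_apply, solution_initial hX hw]; linarith⟩)
  have := ((h₂.mono hs.2).eqOn_of_final_eq hf hg hw.continuousOn (h₁.mono hs.2)
    (sub_eq_zero.1 hs0)) ⟨le_rfl, hs.1⟩
  rw [solution_initial hX hw, solution_initial hX hw] at this
  exact hlt.ne' this

/-- The bound is uniform over all paths and initial values of size at most `M`; it supplies the
boundedness required by `SolvesOn.exists_lipschitz`. -/
theorem exists_abs_solution_le (hf : ContDiff ℝ 1 (fun p : ℝ × ℝ => f p.1 p.2))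
    (hg : LocallyIntegrable g) (hh : LocallyIntegrable h) (hν : 0 ≤ ν)
    (hdiss : ∀ t x, f t x * x ≤ -ν * x ^ 2 + h t * |x|) (δ a b M : ℝ) :
    ∃ N, ∀ (w x : ℝ → ℝ) (x₀ : ℝ), Continuous w →
      SolvesOn (fun t x => f t x + g t) δ w a b x₀ x → (∀ s ∈ Icc a b, |w s| ≤ M) → |x₀| ≤ M →
      ∀ s ∈ Icc a b, |x s| ≤ N := by
  set q : ℝ → ℝ := fun s => |g s| + |h s| with hq
  have hq0 : ∀ s, 0 ≤ q s := fun s => by positivity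
  have hqL : LocallyIntegrable q := by
    refine LocallyIntegrable.add (fun t => ?_) (fun t => ?_)
    · exact (hg t).norm
    · exact (hh t).norm
  set E := Real.exp (|δ| * M) with hE
  have hexp : ∀ (c p : ℝ), |c| = |δ| → |p| ≤ M → Real.exp (c * p) ≤ E := fun c p hc hp => by
    rw [hE, Real.exp_le_exp, ← hc]
    calc c * p ≤ |c * p| := le_abs_self _
      _ = |c| * |p| := abs_mul _ _
      _ ≤ _ := mul_le_mul_of_nonneg_left hp (abs_nonneg _)
  refine ⟨E * (E * M + E * ∫ s in a..b, q s), fun w x x₀ hw hx hwM hx₀ s hs => ?_⟩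
  have hab := hs.1.trans hs.2
  have haI : a ∈ Icc a b := ⟨le_rfl, hab⟩
  have h1 := hx.exp_mul_abs_le_add_integral hw
    (intervalIntegrable_exp_mul_add hf.continuous hg hw.continuousOn hx.1 hab) hqL hq0
    (fun s y hy => by
      have := le_of_dissipative (g := g) hdiss s hy
      simp only [hq]
      nlinarith)
    (fun s y hy => by
      have := ge_of_dissipative (g := g) hdiss s hy
      simp only [hq]
      nlinarith) s hs
  have h2 : ∫ r in a..s, Real.exp (-δ * w r) * q r ≤ E * ∫ r in a..b, q r := by
    rw [← intervalIntegral.integral_const_mul]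
    calc _ ≤ ∫ r in a..b, Real.exp (-δ * w r) * q r :=
          intervalIntegral.integral_mono_interval le_rfl hs.1 hs.2
            (ae_of_all _ fun s => mul_nonneg (Real.exp_pos _).le (hq0 s))
            (intervalIntegrable_exp_mul hw hqL _ _)
      _ ≤ _ := intervalIntegral.integral_mono_on hab (intervalIntegrable_exp_mul hw hqL _ _)
          (hqL.intervalIntegrable_of_real.const_mul _) fun r hr =>
          mul_le_mul_of_nonneg_right (hexp _ _ (abs_neg _) (hwM r hr)) (hq0 r)
  have h3 : Real.exp (-δ * w a) * |x₀| ≤ E * M :=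
    mul_le_mul (hexp _ _ (abs_neg _) (hwM a haI)) hx₀ (abs_nonneg _) (Real.exp_pos _).le
  have h4 : |x s| = Real.exp (δ * w s) * (Real.exp (-δ * w s) * |x s|) := by
    rw [← mul_assoc, ← Real.exp_add]; simp
  rw [h4]
  exact mul_le_mul (hexp _ _ rfl (hwM s hs)) (by linarith) (by positivity) (Real.exp_pos _).le

/-- On the unit ball around a given pair, paths, initial values and solutions are uniformly bounded,
so the local Lipschitz estimate applies. Paths live on the compact interval `[τ, t]`, where the
supremum norm makes them a separable normed space. -/
theorem continuous_solutionMap (hf : ContDiff ℝ 1 (fun p : ℝ × ℝ => f p.1 p.2))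
    (hg : LocallyIntegrable g) (hh : LocallyIntegrable h) (hν : 0 ≤ ν)
    (hdiss : ∀ t x, f t x * x ≤ -ν * x ^ 2 + h t * |x|)
    (hX : ∀ w, Continuous w → ∀ τ x₀,
      IsPathwiseSolution (fun t x => f t x + g t) δ w τ x₀ (X w τ x₀))
    {τ t : ℝ} (ht : τ ≤ t) :
    Continuous fun p : C(Icc τ t, ℝ) × ℝ => X (IccExtend ht p.1) τ p.2 t := by
  refine continuous_iff_continuousAt.2 fun p₀ => ?_
  set M := ‖p₀‖ + 1 with hM
  obtain ⟨N, hN⟩ := exists_abs_solution_le (g := g) hf hg hh hν hdiss δ τ t M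
  obtain ⟨C, hC⟩ := SolvesOn.exists_lipschitz hf hg δ ht (max M N)
  have hw : ∀ p : C(Icc τ t, ℝ) × ℝ, Continuous (IccExtend ht p.1) := fun p =>
    p.1.continuous.Icc_extend'
  have hsol := fun p : C(Icc τ t, ℝ) × ℝ => (hX _ (hw p) τ p.2).solvesOn t
  have hpM : ∀ p, dist p p₀ < 1 → ‖p‖ ≤ M := fun p hp => by
    have := norm_sub_norm_le p p₀
    rw [dist_eq_norm] at hp
    linarith
  have bw : ∀ p : C(Icc τ t, ℝ) × ℝ, ‖p‖ ≤ M → ∀ s ∈ Icc τ t, |IccExtend ht p.1 s| ≤ M :=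
    fun p hp s _ => (p.1.norm_coe_le_norm _).trans ((norm_fst_le p).trans hp)
  have bx : ∀ p : C(Icc τ t, ℝ) × ℝ, ‖p‖ ≤ M → ∀ s ∈ Icc τ t,
      |X (IccExtend ht p.1) τ p.2 s| ≤ N := fun p hp =>
    hN _ _ _ (hw p) (hsol p) (bw p hp) ((norm_snd_le p).trans hp)
  refine continuousAt_of_locally_lipschitz zero_lt_one C fun p hp => ?_
  have h0 := hpM p₀ (by simp)
  have h1 := hpM p hp
  rw [Real.dist_eq]
  refine hC _ _ _ _ _ _ (dist p p₀) (hw p).continuousOn (hw p₀).continuousOn (hsol p) (hsol p₀)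
    (fun s hs => (bw p h1 s hs).trans (le_max_left _ _))
    (fun s hs => (bw p₀ h0 s hs).trans (le_max_left _ _))
    (fun s hs => (bx p h1 s hs).trans (le_max_right _ _))
    (fun s hs => (bx p₀ h0 s hs).trans (le_max_right _ _)) (fun s _ => ?_) ?_ t ⟨ht, le_rfl⟩
  · rw [← Real.dist_eq]
    exact (ContinuousMap.dist_apply_le_dist (f := p.1) (g := p₀.1) _).trans (le_max_left _ _)
  · rw [← Real.dist_eq]
    exact le_max_right _ _

theorem continuous_solution_initialValue (hf : ContDiff ℝ 1 (fun p : ℝ × ℝ => f p.1 p.2))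
    (hg : LocallyIntegrable g) (hh : LocallyIntegrable h) (hν : 0 ≤ ν)
    (hdiss : ∀ t x, f t x * x ≤ -ν * x ^ 2 + h t * |x|)
    (hX : ∀ w, Continuous w → ∀ τ x₀,
      IsPathwiseSolution (fun t x => f t x + g t) δ w τ x₀ (X w τ x₀))
    {w : ℝ → ℝ} (hw : Continuous w) {τ t : ℝ} (ht : τ ≤ t) :
    Continuous fun x₀ => X w τ x₀ t := by
  set u : C(Icc τ t, ℝ) := ⟨fun r => w r, by fun_prop⟩ with hu
  have h1 := (continuous_solutionMap hf hg hh hν hdiss hX ht).comp (Continuous.prodMk_right u)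
  refine h1.congr fun x₀ => ?_
  refine solution_congr_path hf hg hX (c := 0) hw u.continuous.Icc_extend' ht (fun s hs => ?_) x₀
  rw [IccExtend_of_mem _ _ hs]
  simp [hu]

/-- The solution at time `t` is a functional of the increments of the path after the initial
time. -/
theorem measurable_solution (hf : ContDiff ℝ 1 (fun p : ℝ × ℝ => f p.1 p.2))
    (hg : LocallyIntegrable g) (hh : LocallyIntegrable h) (hν : 0 ≤ ν)
    (hdiss : ∀ t x, f t x * x ≤ -ν * x ^ 2 + h t * |x|)
    (hX : ∀ w, Continuous w → ∀ τ x₀,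
      IsPathwiseSolution (fun t x => f t x + g t) δ w τ x₀ (X w τ x₀))
    {Ω : Type*} {W : ℝ → Ω → ℝ} (hW : ∀ ω, Continuous fun t => W t ω) {τ t : ℝ} (ht : τ ≤ t)
    (x₀ : ℝ) :
    Measurable[⨆ r ∈ Icc τ t, MeasurableSpace.comap (fun ω => W r ω - W τ ω) inferInstance]
      fun ω => X (fun s => W s ω) τ x₀ t := by
  -- Subtracting `W τ` does not change the solution and makes every evaluation measurable for the
  -- σ-algebra of increments.
  set G : Ω → C(Icc τ t, ℝ) := fun ω => ⟨fun r => W r ω - W τ ω,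
    ((hW ω).comp continuous_subtype_val).sub continuous_const⟩ with hG
  have : Nonempty (Icc τ t) := ⟨⟨τ, le_rfl, ht⟩⟩
  have h1 := (continuous_solutionMap hf hg hh hν hdiss hX ht).comp (Continuous.prodMk_left x₀)
  have h2 := @measurable_comp_of_continuous_of_measurable_eval Ω (Icc τ t)
    (⨆ r ∈ Icc τ t, MeasurableSpace.comap (fun ω => W r ω - W τ ω) inferInstance)
    _ _ _ _ _ _ h1 G (fun s => ?_)
  · convert! h2 using 1
    funext ω
    refine (solution_congr_path hf hg hX (c := -W τ ω) (hW ω) (G ω).continuous.Icc_extend' ht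
      (fun s hs => ?_) x₀).symm
    rw [IccExtend_of_mem _ _ hs]
    simp [hG, sub_eq_add_neg]
  · refine Measurable.mono (comap_measurable _) ?_ le_rfl
    exact le_iSup₂_of_le (s : ℝ) s.2 le_rfl

end SolutionMap

/-! ### Pullback attractors of strictly monotone cocycles on the line -/

theorem Real.infDist_Icc {l u : ℝ} (hlu : l ≤ u) (x : ℝ) :
    Metric.infDist x (Icc l u) = max 0 (max (l - x) (x - u)) := by
  have hne : (Icc l u).Nonempty := nonempty_Icc.2 hlu
  refine le_antisymm ?_ ?_
  · have hp : max l (min u x) ∈ Icc l u := ⟨le_max_left _ _, max_le hlu (min_le_left _ _)⟩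
    refine (Metric.infDist_le_dist_of_mem hp).trans ?_
    rw [Real.dist_eq, abs_le]
    rcases le_total u x with h1 | h1
    · rw [min_eq_left h1, max_eq_right hlu, max_eq_right (a := l - x) (by linarith)]
      exact ⟨by linarith [le_max_left 0 (x - u), sub_nonneg.2 h1], le_max_right _ _⟩
    · rw [min_eq_right h1]
      rcases le_total l x with h2 | h2
      · rw [max_eq_right h2, sub_self]
        exact ⟨by linarith [le_max_left 0 (max (l - x) (x - u))], le_max_left _ _⟩
      · rw [max_eq_left h2]
        have := (le_max_left (l - x) (x - u)).trans (le_max_right 0 _)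
        exact ⟨by linarith, by linarith [le_max_left 0 (max (l - x) (x - u))]⟩
  · refine (Metric.le_infDist hne).2 fun y hy => ?_
    rw [Real.dist_eq]
    exact max_le (abs_nonneg _) (max_le (by linarith [neg_abs_le (x - y), hy.1])
      (by linarith [le_abs_self (x - y), hy.2]))

section General

variable {Ω X : Type*} [MeasurableSpace Ω] {θ : ℝ → Ω → Ω}

/-- A set that is reached from a family in the universe at arbitrarily remote times lies in the
attractor. -/
theorem IsPullbackAttractor.subset_of_forall_subset_image [MetricSpace X]
    {𝒟 : Set (ℝ → Ω → Set X)} {Φ : ℝ≥0 → ℝ → Ω → X → X} {A B : ℝ → Ω → Set X}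
    (hA : IsPullbackAttractor θ 𝒟 Φ A) (hB : B ∈ 𝒟) {τ : ℝ} {ω : Ω}
    {S : Set X} (hS : ∀ t : ℝ≥0, S ⊆ Φ t (τ - t) (θ (-t) ω) '' B (τ - t) (θ (-t) ω)) :
    S ⊆ A τ ω := by
  intro a ha
  have h1 : Metric.infEDist a (A τ ω) ≤ 0 := by
    refine ge_of_tendsto' (hA.attracts B hB τ ω) fun t => ?_
    exact le_iSup₂_of_le (f := fun a _ => Metric.infEDist a (A τ ω)) a (hS t ha) le_rfl
  rw [← (hA.isCompact τ ω).isClosed.closure_eq, Metric.mem_closure_iff_infEDist_zero]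
  exact nonpos_iff_eq_zero.1 h1

end General

section Monotone

variable {Ω : Type*} {θ : ℝ → Ω → Ω} {Φ : ℝ≥0 → ℝ → Ω → ℝ → ℝ}

/-- The state at time `τ` of the solution that starts on the section `σ` at time `τ - t`. -/
def pullback (θ : ℝ → Ω → Ω) (Φ : ℝ≥0 → ℝ → Ω → ℝ → ℝ) (σ : ℝ → Ω → ℝ) (τ : ℝ) (ω : Ω)
    (t : ℝ≥0) : ℝ :=
  Φ t (τ - t) (θ (-t) ω) (σ (τ - t) (θ (-t) ω))

variable [MeasurableSpace Ω]

theorem apply_add_pullback (hΦ : IsContinuousCocycle θ Φ)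
    (hθ : ∀ s t ω, θ s (θ t ω) = θ (s + t) ω) (t s : ℝ≥0) (τ : ℝ) (ω : Ω) (x : ℝ) :
    Φ (t + s) (τ - (t + s : ℝ≥0)) (θ (-(t + s : ℝ≥0)) ω) x =
      Φ t (τ - t) (θ (-t) ω) (Φ s (τ - t - s) (θ (-s) (θ (-t) ω)) x) := by
  have e1 : τ - ((t + s : ℝ≥0) : ℝ) = τ - t - s := by push_cast; ring
  have e2 : θ (-((t + s : ℝ≥0) : ℝ)) ω = θ (-s) (θ (-t) ω) := by
    rw [hθ]; congr 1; push_cast; ring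
  have e3 : θ s (θ (-s) (θ (-t) ω)) = θ (-t) ω := by
    rw [hθ, hθ]; congr 1; ring
  rw [e1, e2, hΦ.cocycle, e3, sub_add_cancel]

theorem pullback_add (hΦ : IsContinuousCocycle θ Φ)
    (hθ : ∀ s t ω, θ s (θ t ω) = θ (s + t) ω) (σ : ℝ → Ω → ℝ) (t s : ℝ≥0) (τ : ℝ) (ω : Ω) :
    pullback θ Φ σ τ ω (t + s) =
      Φ t (τ - t) (θ (-t) ω) (pullback θ Φ σ (τ - t) (θ (-t) ω) s) := by
  have e1 : τ - ((t + s : ℝ≥0) : ℝ) = τ - t - s := by push_cast; ring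
  have e2 : θ (-((t + s : ℝ≥0) : ℝ)) ω = θ (-s) (θ (-t) ω) := by
    rw [hθ]; congr 1; push_cast; ring
  rw [pullback, apply_add_pullback hΦ hθ, pullback, e1, e2]

/-- By the cocycle property, flowing a pullback forward by `t` is the pullback at the later time
over a duration longer by `t`; continuity in the state passes to the limit. -/
theorem apply_eq_of_tendsto_pullback (hΦ : IsContinuousCocycle θ Φ) (hθ₀ : ∀ ω, θ 0 ω = ω)
    (hθ : ∀ s t ω, θ s (θ t ω) = θ (s + t) ω) {σ u : ℝ → Ω → ℝ}
    (hu : ∀ τ ω, Tendsto (pullback θ Φ σ τ ω) atTop (𝓝 (u τ ω))) (t : ℝ≥0) (τ : ℝ) (ω : Ω) :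
    Φ t τ ω (u τ ω) = u (τ + t) (θ t ω) := by
  have h1 : Tendsto (fun s => Φ t τ ω (pullback θ Φ σ τ ω s)) atTop (𝓝 (Φ t τ ω (u τ ω))) :=
    ((hΦ.continuous t τ ω).tendsto _).comp (hu τ ω)
  have h2 : Tendsto (fun s => pullback θ Φ σ (τ + t) (θ t ω) (t + s)) atTop
      (𝓝 (u (τ + t) (θ t ω))) :=
    (hu _ _).comp (tendsto_atTop_mono (fun s => le_add_self) tendsto_id)
  refine tendsto_nhds_unique h1 (h2.congr fun s => ?_)
  rw [pullback_add hΦ hθ, hθ, neg_add_cancel, hθ₀, add_sub_cancel_right]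

theorem measurable_of_tendsto_pullback (hΦ : IsContinuousCocycle θ Φ)
    (hθm : ∀ t, Measurable (θ t)) {σ u : ℝ → Ω → ℝ} (hσ : ∀ τ, Measurable (σ τ))
    (hu : ∀ τ ω, Tendsto (pullback θ Φ σ τ ω) atTop (𝓝 (u τ ω))) (τ : ℝ) : Measurable (u τ) := by
  refine measurable_of_tendsto_metrizable (f := fun (n : ℕ) ω => pullback θ Φ σ τ ω n)
    (fun n => ?_) (tendsto_pi_nhds.2 fun ω => (hu τ ω).comp tendsto_natCast_atTop_atTop)
  exact (hΦ.measurable (τ - (n : ℝ≥0))).comp (measurable_const.prodMk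
    ((hθm _).prodMk ((hσ _).comp (hθm _))))

theorem image_Icc_of_strictMono {φ : ℝ → ℝ} (hc : Continuous φ) (hm : StrictMono φ) {l u : ℝ}
    (hlu : l ≤ u) : φ '' Icc l u = Icc (φ l) (φ u) := by
  refine Subset.antisymm ?_ (intermediate_value_Icc hlu hc.continuousOn)
  rintro _ ⟨x, hx, rfl⟩
  exact ⟨hm.monotone hx.1, hm.monotone hx.2⟩

/-- Every point of an invariant family of a cocycle with injective time maps lies on a complete
quasi-solution in that family. -/
theorem exists_isCompleteQuasiSolution (hΦ : IsContinuousCocycle θ Φ) (hθ₀ : ∀ ω, θ 0 ω = ω)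
    (hθ : ∀ s t ω, θ s (θ t ω) = θ (s + t) ω) (hinj : ∀ t τ ω, Function.Injective (Φ t τ ω))
    {A : ℝ → Ω → Set ℝ} (hA : ∀ (t : ℝ≥0) τ ω, Φ t τ ω '' A τ ω = A (τ + t) (θ t ω))
    {u : ℝ → Ω → ℝ} (hu : IsCompleteQuasiSolution θ Φ u) (huA : ∀ τ ω, u τ ω ∈ A τ ω)
    {τ₀ : ℝ} {ω₀ : Ω} {x₀ : ℝ} (hx₀ : x₀ ∈ A τ₀ ω₀) :
    ∃ ξ, IsCompleteQuasiSolution θ Φ ξ ∧ (∀ τ ω, ξ τ ω ∈ A τ ω) ∧ ξ τ₀ ω₀ = x₀ := by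
  classical
  -- The orbit of `(τ₀, ω₀)` in time and sample. The time label keeps the construction unambiguous
  -- even if the `θ`-orbit of `ω₀` is periodic.
  set o : ℝ → Ω := fun s => θ (s - τ₀) ω₀ with ho
  have hoshift : ∀ (t s : ℝ), θ t (o s) = o (s + t) := fun t s => by
    simp only [ho, hθ]; congr 1; ring
  have ho₀ : o τ₀ = ω₀ := by simp [ho, hθ₀]
  set E : ℝ → ℝ → ℝ → ℝ := fun s t x => Φ (t - s).toNNReal s (o s) x with hE
  have hcoe : ∀ {s t : ℝ}, s ≤ t → (((t - s).toNNReal : ℝ≥0) : ℝ) = t - s := fun h =>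
    Real.coe_toNNReal _ (sub_nonneg.2 h)
  have hEE : ∀ {r s t : ℝ}, r ≤ s → s ≤ t → ∀ x, E s t (E r s x) = E r t x := by
    intro r s t hrs hst x
    have h1 : (t - r).toNNReal = (t - s).toNNReal + (s - r).toNNReal := by
      rw [← Real.toNNReal_add (sub_nonneg.2 hst) (sub_nonneg.2 hrs)]; congr 1; ring
    simp only [hE]
    rw [h1, hΦ.cocycle, hcoe hrs, hoshift, add_sub_cancel]
  have hEid : ∀ s x, E s s x = x := fun s x => by simp [hE, hΦ.zero]
  have hEA : ∀ {s t : ℝ}, s ≤ t → E s t '' A s (o s) = A t (o t) := by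
    intro s t hst
    have := hA (t - s).toNNReal s (o s)
    rwa [hcoe hst, hoshift, add_sub_cancel] at this
  have hback : ∀ s, ∃ y, s ≤ τ₀ → y ∈ A s (o s) ∧ E s τ₀ y = x₀ := by
    intro s
    by_cases hs : s ≤ τ₀
    · have : x₀ ∈ E s τ₀ '' A s (o s) := by rw [hEA hs, ho₀]; exact hx₀
      obtain ⟨y, hy, hy'⟩ := this
      exact ⟨y, fun _ => ⟨hy, hy'⟩⟩
    · exact ⟨0, fun h => absurd h hs⟩
  choose y hy using hback
  -- Injectivity makes independently chosen preimages of `x₀` fit together into one backward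
  -- trajectory.
  have hcoh : ∀ {s s' : ℝ}, s ≤ s' → s' ≤ τ₀ → E s s' (y s) = y s' := fun {s s'} h h' => by
    refine hinj (τ₀ - s').toNNReal s' (o s') ?_
    change E s' τ₀ (E s s' (y s)) = E s' τ₀ (y s')
    rw [hEE h h', (hy s (h.trans h')).2, (hy s' h').2]
  set v : ℝ → ℝ := fun t => E (min t τ₀) t (y (min t τ₀)) with hv
  have hvE : ∀ {s t : ℝ}, s ≤ t → E s t (v s) = v t := fun {s t} hst => by
    simp only [hv]
    rw [hEE (min_le_left _ _) hst, ← hcoh (min_le_min_right τ₀ hst) (min_le_right _ _),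
      hEE (min_le_min_right τ₀ hst) (min_le_left _ _)]
  have hvA : ∀ t, v t ∈ A t (o t) := fun t => by
    rw [← hEA (min_le_left t τ₀)]
    exact mem_image_of_mem _ (hy _ (min_le_right _ _)).1
  have hv₀ : v τ₀ = x₀ := by
    have := (hy τ₀ le_rfl).2
    simp only [hv, min_self, hEid] at this ⊢
    exact this
  -- The orbit and its complement are both preserved by the flow, so the two definitions never mix.
  refine ⟨fun τ ω => if ω = o τ then v τ else u τ ω, fun t τ ω => ?_, fun τ ω => ?_, ?_⟩
  · by_cases hω : ω = o τ
    · subst hω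
      have h1 : τ ≤ τ + t := le_add_of_nonneg_right t.2
      have h2 := hvE h1
      have h3 : (τ + t - τ).toNNReal = t := by simp
      simp only [hE, h3] at h2
      simp only [hoshift, if_true, h2]
    · have h1 : θ t ω ≠ o (τ + t) := fun h => hω (by
        have h2 := congrArg (θ (-t)) h
        rwa [hθ, neg_add_cancel, hθ₀, hoshift, add_neg_cancel_right] at h2)
      simp only [if_neg hω, if_neg h1]
      exact hu t τ ω
  · by_cases hω : ω = o τ
    · simp only [if_pos hω]
      rw [hω]
      exact hvA τ
    · simp only [if_neg hω]
      exact huA τ ω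
  · simp only [ho₀, if_true, hv₀]

/-- A strictly monotone cocycle on `ℝ` with a tempered, absorbing, positively invariant
symmetric interval has a unique pullback attractor, made of the complete quasi-solutions. -/
theorem exists_isPullbackAttractor_of_strictMono (hΦ : IsContinuousCocycle θ Φ)
    (hθ₀ : ∀ ω, θ 0 ω = ω) (hθ : ∀ s t ω, θ s (θ t ω) = θ (s + t) ω)
    (hθm : ∀ t, Measurable (θ t)) (hmono : ∀ t τ ω, StrictMono (Φ t τ ω)) {ρ : ℝ → Ω → ℝ}
    (hρ₀ : ∀ τ ω, 0 ≤ ρ τ ω) (hρm : ∀ τ, Measurable (ρ τ))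
    (hρinv : ∀ (t : ℝ≥0) τ ω x, |x| ≤ ρ τ ω → |Φ t τ ω x| ≤ ρ (τ + t) (θ t ω))
    (hρtemp : ∀ c > 0, ∀ τ ω,
      Tendsto (fun t : ℝ => Real.exp (c * t) * ρ (τ + t) (θ t ω)) atBot (𝓝 0))
    (hρabs : ∀ B ∈ temperedFamilies θ, ∀ τ ω, ∀ᶠ t : ℝ≥0 in atTop,
      ∀ x ∈ B (τ - t) (θ (-t) ω), |Φ t (τ - t) (θ (-t) ω) x| ≤ ρ τ ω) :
    ∃ A : ℝ → Ω → Set ℝ, IsPullbackAttractor θ (temperedFamilies θ) Φ A ∧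
      (∀ A' : ℝ → Ω → Set ℝ, IsPullbackAttractor θ (temperedFamilies θ) Φ A' → A' = A) ∧
      ∀ τ ω, A τ ω = {x | ∃ ξ : ℝ → Ω → ℝ,
        IsDCompleteQuasiSolution θ (temperedFamilies θ) Φ ξ ∧ ξ τ ω = x} := by
  have hcancel : ∀ (t : ℝ) ω, θ t (θ (-t) ω) = ω := fun t ω => by rw [hθ, add_neg_cancel, hθ₀]
  have hinv' : ∀ (t : ℝ≥0) τ ω x, |x| ≤ ρ (τ - t) (θ (-t) ω) →
      |Φ t (τ - t) (θ (-t) ω) x| ≤ ρ τ ω := fun t τ ω x hx => by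
    have := hρinv t _ _ x hx
    rwa [hcancel, sub_add_cancel] at this
  set σ : ℝ → Ω → ℝ := fun τ ω => -ρ τ ω with hσ
  have hpρ : ∀ τ ω t, |pullback θ Φ ρ τ ω t| ≤ ρ τ ω := fun τ ω t =>
    hinv' t τ ω _ (abs_of_nonneg (hρ₀ _ _)).le
  have hpσ : ∀ τ ω t, |pullback θ Φ σ τ ω t| ≤ ρ τ ω := fun τ ω t =>
    hinv' t τ ω _ (by simp only [hσ, abs_neg]; exact (abs_of_nonneg (hρ₀ _ _)).le)
  -- A longer pullback first flows the endpoint `ρ` to a point not above `ρ`, by positive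
  -- invariance, and then applies an increasing map.
  have hanti : ∀ τ ω, Antitone (pullback θ Φ ρ τ ω) := fun τ ω s t hst => by
    obtain ⟨r, rfl⟩ := exists_add_of_le hst
    rw [pullback_add hΦ hθ]
    exact (hmono _ _ _).monotone ((le_abs_self _).trans (hpρ _ _ _))
  have hmon : ∀ τ ω, Monotone (pullback θ Φ σ τ ω) := fun τ ω s t hst => by
    obtain ⟨r, rfl⟩ := exists_add_of_le hst
    rw [pullback_add hΦ hθ]
    exact (hmono _ _ _).monotone (neg_le_of_abs_le (hpσ _ _ _))
  set u : ℝ → Ω → ℝ := fun τ ω => ⨅ t, pullback θ Φ ρ τ ω t with hu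
  set l : ℝ → Ω → ℝ := fun τ ω => ⨆ t, pullback θ Φ σ τ ω t with hl
  have hut : ∀ τ ω, Tendsto (pullback θ Φ ρ τ ω) atTop (𝓝 (u τ ω)) := fun τ ω =>
    tendsto_atTop_ciInf (hanti τ ω) ⟨-ρ τ ω, by
      rintro _ ⟨t, rfl⟩; exact neg_le_of_abs_le (hpρ τ ω t)⟩
  have hlt : ∀ τ ω, Tendsto (pullback θ Φ σ τ ω) atTop (𝓝 (l τ ω)) := fun τ ω =>
    tendsto_atTop_ciSup (hmon τ ω) ⟨ρ τ ω, by
      rintro _ ⟨t, rfl⟩; exact le_of_abs_le (hpσ τ ω t)⟩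
  have hlu : ∀ τ ω, l τ ω ≤ u τ ω := fun τ ω => le_of_tendsto_of_tendsto' (hlt τ ω) (hut τ ω)
    fun t => (hmono _ _ _).monotone (by simp only [hσ]; linarith [hρ₀ (τ - t) (θ (-t) ω)])
  have huρ : ∀ τ ω, u τ ω ≤ ρ τ ω := fun τ ω =>
    le_of_tendsto' (hut τ ω) fun t => le_of_abs_le (hpρ τ ω t)
  have hlρ : ∀ τ ω, -ρ τ ω ≤ l τ ω := fun τ ω =>
    ge_of_tendsto' (hlt τ ω) fun t => neg_le_of_abs_le (hpσ τ ω t)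
  set A : ℝ → Ω → Set ℝ := fun τ ω => Icc (l τ ω) (u τ ω) with hA
  have hinvA : ∀ (t : ℝ≥0) τ ω, Φ t τ ω '' A τ ω = A (τ + t) (θ t ω) := fun t τ ω => by
    simp only [hA]
    rw [image_Icc_of_strictMono (hΦ.continuous t τ ω) (hmono t τ ω) (hlu τ ω),
      apply_eq_of_tendsto_pullback hΦ hθ₀ hθ hut, apply_eq_of_tendsto_pullback hΦ hθ₀ hθ hlt]
  have hmem : A ∈ temperedFamilies θ := by
    refine ⟨fun τ ω => ⟨nonempty_Icc.2 (hlu τ ω), Metric.isBounded_Icc _ _⟩, fun c hc τ ω => ?_⟩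
    refine squeeze_zero (fun t => ?_) (fun t => ?_) (hρtemp c hc τ ω)
    · refine mul_nonneg (Real.exp_pos _).le (Real.sSup_nonneg ?_)
      rintro _ ⟨x, -, rfl⟩
      exact abs_nonneg x
    · refine mul_le_mul_of_nonneg_left (csSup_le ((nonempty_Icc.2 (hlu _ _)).image _) ?_)
        (Real.exp_pos _).le
      rintro _ ⟨x, hx, rfl⟩
      exact abs_le.2 ⟨(hlρ _ _).trans hx.1, hx.2.trans (huρ _ _)⟩
  have hatt : IsPullbackAttractor θ (temperedFamilies θ) Φ A := by
    refine ⟨hmem, fun τ x => ?_, fun τ ω => isCompact_Icc, hinvA, fun B hB τ ω => ?_⟩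
    · simp only [hA, Real.infDist_Icc (hlu _ _)]
      have h1 := measurable_of_tendsto_pullback hΦ hθm hρm hut τ
      have h2 := measurable_of_tendsto_pullback hΦ hθm (σ := σ) (fun τ => (hρm τ).neg) hlt τ
      exact measurable_const.max ((h2.sub_const x).max (h1.const_sub x))
    · refine ENNReal.tendsto_nhds_zero.2 fun ε hε => ?_
      obtain ⟨r, hr0, hrε⟩ := ENNReal.lt_iff_exists_nnreal_btwn.1 hε
      have hr0' : (0 : ℝ) < r := by exact_mod_cast hr0
      -- At `T` both pulled-back endpoints are within `r` of the attractor. Once the family has been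
      -- absorbed at time `τ - T`, monotonicity traps it between them.
      obtain ⟨T, hTu, hTl⟩ := (((hut τ ω).eventually_lt_const
        (lt_add_of_pos_right (u τ ω) hr0')).and ((hlt τ ω).eventually_const_lt
        (sub_lt_self (l τ ω) hr0'))).exists
      obtain ⟨S, hS⟩ := eventually_atTop.1 (hρabs B hB (τ - T) (θ (-T) ω))
      filter_upwards [eventually_ge_atTop (T + S)] with t ht
      obtain ⟨s, rfl⟩ := exists_add_of_le (le_self_add.trans ht)
      have hs : S ≤ s := le_of_add_le_add_left ht
      refine iSup₂_le fun a ha => (le_trans ?_ hrε.le)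
      obtain ⟨x, hx, rfl⟩ := ha
      rw [apply_add_pullback hΦ hθ]
      have e1 : τ - ((T + s : ℝ≥0) : ℝ) = τ - T - s := by push_cast; ring
      have e2 : θ (-((T + s : ℝ≥0) : ℝ)) ω = θ (-s) (θ (-T) ω) := by
        rw [hθ]; congr 1; push_cast; ring
      rw [e1, e2] at hx
      have hz := abs_le.1 (hS s hs x hx)
      set z := Φ s (τ - T - s) (θ (-s) (θ (-T) ω)) x with hzdef
      have h1 : Φ T (τ - T) (θ (-T) ω) z ≤ pullback θ Φ ρ τ ω T := (hmono _ _ _).monotone hz.2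
      have h2 : pullback θ Φ σ τ ω T ≤ Φ T (τ - T) (θ (-T) ω) z := (hmono _ _ _).monotone hz.1
      set b := Φ T (τ - T) (θ (-T) ω) z
      have hb : Metric.infDist b (A τ ω) ≤ r := by
        simp only [hA, Real.infDist_Icc (hlu τ ω)]
        exact max_le r.2 (max_le (by linarith) (by linarith))
      have hne : Metric.infEDist b (A τ ω) ≠ ⊤ :=
        Metric.infEDist_ne_top (nonempty_Icc.2 (hlu τ ω))
      rw [Metric.infDist] at hb
      rw [← ENNReal.ofReal_toReal hne, ← ENNReal.ofReal_coe_nnreal]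
      exact ENNReal.ofReal_le_ofReal hb
  have himg : ∀ A', IsPullbackAttractor θ (temperedFamilies θ) Φ A' → ∀ τ ω (t : ℝ≥0),
      A' τ ω ⊆ Φ t (τ - t) (θ (-t) ω) '' A' (τ - t) (θ (-t) ω) := fun A' hA' τ ω t => by
    rw [hA'.invariant, hcancel, sub_add_cancel]
  refine ⟨A, hatt, fun A' hA' => ?_, fun τ ω => ?_⟩
  · funext τ ω
    exact Subset.antisymm
      (hatt.subset_of_forall_subset_image hA'.mem (himg A' hA' τ ω))
      (hA'.subset_of_forall_subset_image hmem (himg A hatt τ ω))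
  · refine Subset.antisymm (fun x hx => ?_) ?_
    · obtain ⟨ξ, h1, h2, h3⟩ := exists_isCompleteQuasiSolution hΦ hθ₀ hθ
        (fun t τ ω => (hmono t τ ω).injective) hinvA (u := u)
        (fun t τ ω => apply_eq_of_tendsto_pullback hΦ hθ₀ hθ hut t τ ω)
        (fun τ ω => right_mem_Icc.2 (hlu τ ω)) hx
      exact ⟨ξ, ⟨h1, A, hmem, h2⟩, h3⟩
    · rintro x ⟨ξ, ⟨hξ, D, hD, hξD⟩, rfl⟩
      -- The value of a complete quasi-solution is the image of its own past value in `D`, from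
      -- every past time.
      refine hatt.subset_of_forall_subset_image (S := {ξ τ ω}) hD (fun t => ?_) rfl
      rw [singleton_subset_iff]
      refine ⟨_, hξD _ _, ?_⟩
      rw [hξ, hcancel, sub_add_cancel]

end Monotone

/-! ### Convergence of the trapezoidal sums -/

/-- The trapezoidal rule matches the exponential to second order, so only a cubic error remains;
this is why cubic variation decides the convergence. -/
theorem abs_exp_sub_trapezoid_le {d : ℝ} (hd : |d| ≤ 1) :
    |Real.exp d - 1 - d * ((1 + Real.exp d) / 2)| ≤ |d| ^ 3 := by
  have h3 := Real.exp_bound hd (n := 3) (by norm_num)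
  have h2 := Real.exp_bound hd (n := 2) (by norm_num)
  norm_num [Finset.sum_range_succ, Nat.factorial] at h2 h3
  have e : Real.exp d - 1 - d * ((1 + Real.exp d) / 2) =
      (Real.exp d - (1 + d + d ^ 2 / 2)) - d / 2 * (Real.exp d - (1 + d)) := by ring
  have h4 : |d / 2 * (Real.exp d - (1 + d))| ≤ |d| / 2 * (|d| ^ 2 * (3 / 4)) := by
    rw [abs_mul, abs_div, abs_two]
    exact mul_le_mul_of_nonneg_left (by simpa using h2) (by positivity)
  have h5 : 0 ≤ |d| ^ 3 := by positivity
  rw [e]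
  refine (abs_sub _ _).trans ?_
  nlinarith

theorem abs_exp_sub_exp_sub_trapezoid_le {p q : ℝ} (h : |q - p| ≤ 1) :
    |Real.exp q - Real.exp p - (q - p) * ((Real.exp p + Real.exp q) / 2)| ≤
      Real.exp p * |q - p| ^ 3 := by
  have e : Real.exp q = Real.exp p * Real.exp (q - p) := by rw [← Real.exp_add]; ring_nf
  have e2 : Real.exp q - Real.exp p - (q - p) * ((Real.exp p + Real.exp q) / 2) =
      Real.exp p * (Real.exp (q - p) - 1 - (q - p) * ((1 + Real.exp (q - p)) / 2)) := by
    rw [e]; ring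
  rw [e2, abs_mul, Real.abs_exp]
  exact mul_le_mul_of_nonneg_left (abs_exp_sub_trapezoid_le h) (Real.exp_pos _).le

namespace SolvesOn

variable {F : ℝ → ℝ → ℝ} {δ a b x₀ : ℝ} {w x : ℝ → ℝ}

/-- Error of the trapezoidal rule on one interval. -/
theorem abs_trapezoid_error_le (hx : SolvesOn F δ w a b x₀ x) (hw : ContinuousOn w (Icc a b))
    (hF : IntervalIntegrable (fun s => Real.exp (-δ * w s) * F s (x s)) volume a b)
    {C ε : ℝ} (hC₁ : ∀ s ∈ Icc a b, Real.exp (δ * w s) ≤ C)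
    (hC₂ : ∀ s ∈ Icc a b, |Real.exp (-δ * w s) * x s| ≤ C)
    {s t : ℝ} (has : a ≤ s) (hst : s ≤ t) (htb : t ≤ b)
    (hε : ∀ r ∈ Icc s t, ∀ r' ∈ Icc s t, |Real.exp (δ * w r) - Real.exp (δ * w r')| ≤ ε)
    (hd : |δ * w t - δ * w s| ≤ 1) :
    |x t - x s - (∫ r in s..t, F r (x r)) - δ * ((x s + x t) / 2 * (w t - w s))| ≤
      2 * ε * (∫ r in s..t, |Real.exp (-δ * w r) * F r (x r)|) +
        C ^ 2 * |δ| ^ 3 * |w t - w s| ^ 3 := by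
  have hab := has.trans (hst.trans htb)
  have hsub : Icc s t ⊆ Icc a b := Icc_subset_Icc has htb
  have hsI : s ∈ Icc s t := ⟨le_rfl, hst⟩
  have htI : t ∈ Icc s t := ⟨hst, le_rfl⟩
  have hvi : IntervalIntegrable (fun s => Real.exp (-δ * w s) * F s (x s)) volume s t :=
    hF.mono_set (by rw [uIcc_of_le hst, uIcc_of_le hab]; exact hsub)
  have hcancel : ∀ p z : ℝ, Real.exp (δ * p) * (Real.exp (-δ * p) * z) = z := fun p z => by
    rw [← mul_assoc, ← Real.exp_add]; simp
  have hΔy := hx.sub_eq_integral hF has hst htb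
  set E : ℝ → ℝ := fun r => Real.exp (δ * w r) with hE
  set v : ℝ → ℝ := fun r => Real.exp (-δ * w r) * F r (x r) with hv
  set ys := Real.exp (-δ * w s) * x s with hys
  set yt := Real.exp (-δ * w t) * x t with hyt
  have hEc : ContinuousOn E (uIcc s t) := by
    rw [uIcc_of_le hst]
    exact ((continuousOn_const.mul hw).rexp).mono hsub
  have hεs := hε s hsI
  have hε0 : 0 ≤ ε := (abs_nonneg _).trans (hεs s hsI)
  have hC0 : 0 ≤ C := (Real.exp_pos _).le.trans (hC₁ s (hsub hsI))
  set K := ∫ r in s..t, |v r| with hK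
  have hyK : |yt - ys| ≤ K := by
    rw [hΔy]; exact intervalIntegral.abs_integral_le_integral_abs hst
  have hxs : x s = E s * ys := (hcancel _ _).symm
  have hxt : x t = E t * yt := (hcancel _ _).symm
  have hFE : ∫ r in s..t, F r (x r) = ∫ r in s..t, E r * v r :=
    intervalIntegral.integral_congr fun r _ => (hcancel _ _).symm
  set d := δ * w t - δ * w s with hddef
  -- Discrete product rule: with `x = E y`, the increment of `x` is mean of `E` times increment of
  -- `y` plus mean of `y` times increment of `E`, while the mean of `E y` differs from the product
  -- of the means by a quarter of the product of the increments.
  have key : x t - x s - (∫ r in s..t, F r (x r)) - δ * ((x s + x t) / 2 * (w t - w s)) =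
      (∫ r in s..t, ((E s + E t) / 2 - E r) * v r) +
      (ys + yt) / 2 * (E t - E s - d * ((E s + E t) / 2)) -
      d / 4 * ((E t - E s) * (yt - ys)) := by
    have e1 : ∫ r in s..t, ((E s + E t) / 2 - E r) * v r =
        (E s + E t) / 2 * (yt - ys) - ∫ r in s..t, E r * v r := by
      rw [hΔy, ← intervalIntegral.integral_const_mul, ← intervalIntegral.integral_sub
        (hvi.const_mul _) (hvi.continuousOn_mul hEc)]
      exact intervalIntegral.integral_congr fun r _ => sub_mul _ _ _
    rw [e1, hFE, hxs, hxt, hddef]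
    ring
  have b1 : |∫ r in s..t, ((E s + E t) / 2 - E r) * v r| ≤ ε * K := by
    rw [hK, ← intervalIntegral.integral_const_mul, ← Real.norm_eq_abs]
    refine intervalIntegral.norm_integral_le_of_norm_le hst (ae_of_all _ fun r hr => ?_)
      (hvi.abs.const_mul ε)
    have hr' : r ∈ Icc s t := Ioc_subset_Icc_self hr
    rw [norm_mul, Real.norm_eq_abs, Real.norm_eq_abs]
    refine mul_le_mul_of_nonneg_right ?_ (abs_nonneg _)
    have h1 := abs_le.1 (hε s hsI r hr')
    have h2 := abs_le.1 (hε t htI r hr')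
    simp only [hE]
    exact abs_le.2 ⟨by linarith [h1.1, h2.1], by linarith [h1.2, h2.2]⟩
  have b2 : |(ys + yt) / 2 * (E t - E s - d * ((E s + E t) / 2))| ≤
      C ^ 2 * |δ| ^ 3 * |w t - w s| ^ 3 := by
    have h1 : |(ys + yt) / 2| ≤ C := by
      have h3 := abs_le.1 (hC₂ s (hsub hsI))
      have h4 := abs_le.1 (hC₂ t (hsub htI))
      exact abs_le.2 ⟨by linarith [h3.1, h4.1], by linarith [h3.2, h4.2]⟩
    have h2 : |E t - E s - d * ((E s + E t) / 2)| ≤ C * |d| ^ 3 :=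
      (abs_exp_sub_exp_sub_trapezoid_le hd).trans
        (mul_le_mul_of_nonneg_right (hC₁ s (hsub hsI)) (by positivity))
    rw [abs_mul]
    refine (mul_le_mul h1 h2 (abs_nonneg _) hC0).trans (le_of_eq ?_)
    rw [hddef, ← mul_sub, abs_mul]
    ring
  have b3 : |d / 4 * ((E t - E s) * (yt - ys))| ≤ ε * K := by
    rw [abs_mul, abs_mul, abs_div]
    have h1 : |E t - E s| * |yt - ys| ≤ ε * K :=
      mul_le_mul (hε t htI s hsI) hyK (abs_nonneg _) hε0
    have h2 : |d| / |(4 : ℝ)| ≤ 1 := by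
      rw [abs_of_pos (by norm_num : (0 : ℝ) < 4)]
      linarith
    calc _ ≤ 1 * (ε * K) := mul_le_mul h2 h1 (by positivity) zero_le_one
      _ = _ := one_mul _
  rw [key]
  refine (abs_sub _ _).trans ?_
  have := abs_add_le (∫ r in s..t, ((E s + E t) / 2 - E r) * v r)
    ((ys + yt) / 2 * (E t - E s - d * ((E s + E t) / 2)))
  linarith

/-- Along partitions with vanishing mesh and vanishing cubic variation of the path, the
trapezoidal sums of a pathwise solution converge. -/
theorem tendsto_trapezoid_sum (hx : SolvesOn F δ w a b x₀ x) (hw : ContinuousOn w (Icc a b))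
    (hF : IntervalIntegrable (fun s => Real.exp (-δ * w s) * F s (x s)) volume a b)
    (hab : a ≤ b) (hδ : δ ≠ 0) {m : ℕ → ℕ} {p : ℕ → ℕ → ℝ} (hp : ∀ n, Monotone (p n))
    (ha : ∀ n, p n 0 = a) (hb : ∀ n, p n (m n) = b)
    (hmesh : ∀ ε > 0, ∀ᶠ n in atTop, ∀ i < m n, p n (i + 1) - p n i < ε)
    (hcub : Tendsto (fun n => ∑ i ∈ Finset.range (m n), |w (p n (i + 1)) - w (p n i)| ^ 3)
      atTop (𝓝 0)) :
    Tendsto (fun n => ∑ i ∈ Finset.range (m n),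
      (x (p n i) + x (p n (i + 1))) / 2 * (w (p n (i + 1)) - w (p n i))) atTop
      (𝓝 ((x b - x₀ - ∫ s in a..b, F s (x s)) / δ)) := by
  have hEc : ContinuousOn (fun s => Real.exp (δ * w s)) (Icc a b) :=
    (continuousOn_const.mul hw).rexp
  have hyc : ContinuousOn (fun s => Real.exp (-δ * w s) * x s) (Icc a b) :=
    ((continuousOn_const.mul hw).rexp).mul hx.1
  obtain ⟨C₁, hC₁⟩ := isCompact_Icc.exists_bound_of_continuousOn hEc
  obtain ⟨C₂, hC₂⟩ := isCompact_Icc.exists_bound_of_continuousOn hyc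
  set C := max C₁ C₂ with hC
  set K := ∫ r in a..b, |Real.exp (-δ * w r) * F r (x r)| with hK
  have hK0 : 0 ≤ K := intervalIntegral.integral_nonneg hab fun _ _ => abs_nonneg _
  have hFi : IntervalIntegrable (fun s => F s (x s)) volume a b := by
    have := hF.continuousOn_mul (g := fun s => Real.exp (δ * w s)) (by rwa [uIcc_of_le hab])
    refine this.congr fun s _ => ?_
    rw [← mul_assoc, ← Real.exp_add]
    simp
  have hpI : ∀ n i, i ≤ m n → p n i ∈ Icc a b := fun n i hi =>
    ⟨by rw [← ha n]; exact hp n (Nat.zero_le i), by rw [← hb n]; exact hp n hi⟩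
  have hsubi : ∀ n i, i < m n → uIcc (p n i) (p n (i + 1)) ⊆ uIcc a b := fun n i hi => by
    rw [uIcc_of_le hab, uIcc_of_le (hp n (Nat.le_succ i))]
    exact Icc_subset_Icc (hpI n i hi.le).1 (hpI n (i + 1) hi).2
  have herr : ∀ ε > 0, ∀ᶠ n in atTop,
      |(x b - x₀ - ∫ s in a..b, F s (x s)) - δ * ∑ i ∈ Finset.range (m n),
        (x (p n i) + x (p n (i + 1))) / 2 * (w (p n (i + 1)) - w (p n i))| ≤
      2 * ε * K + C ^ 2 * |δ| ^ 3 *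
        ∑ i ∈ Finset.range (m n), |w (p n (i + 1)) - w (p n i)| ^ 3 := by
    intro ε hε
    obtain ⟨η₁, hη₁, h₁⟩ := Metric.uniformContinuousOn_iff.1
      (isCompact_Icc.uniformContinuousOn_of_continuous hEc) ε hε
    obtain ⟨η₂, hη₂, h₂⟩ := Metric.uniformContinuousOn_iff.1
      (isCompact_Icc.uniformContinuousOn_of_continuous (continuousOn_const (c := δ) |>.mul hw)) 1
      one_pos
    filter_upwards [hmesh _ (lt_min hη₁ hη₂)] with n hn
    have hterm : ∀ i ∈ Finset.range (m n), _ := fun i hi =>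
      have hi' := Finset.mem_range.1 hi
      hx.abs_trapezoid_error_le hw hF (C := C) (ε := ε)
        (fun s hs => ((le_abs_self _).trans (hC₁ s hs)).trans (le_max_left _ _))
        (fun s hs => (hC₂ s hs).trans (le_max_right _ _))
        (hpI n i hi'.le).1 (hp n (Nat.le_succ i)) (hpI n (i + 1) hi').2
        (fun r hr r' hr' => by
          have hI := Icc_subset_Icc (hpI n i hi'.le).1 (hpI n (i + 1) hi').2
          refine (h₁ r (hI hr) r' (hI hr') ?_).le
          have := (hn i hi').trans_le (min_le_left _ _)
          rw [Real.dist_eq]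
          exact abs_lt.2 ⟨by linarith [hr.1, hr'.2], by linarith [hr.2, hr'.1]⟩)
        (by
          refine (h₂ _ (hpI n (i + 1) hi') _ (hpI n i hi'.le) ?_).le
          rw [Real.dist_eq, abs_of_nonneg (sub_nonneg.2 (hp n (Nat.le_succ i)))]
          exact (hn i hi').trans_le (min_le_right _ _))
    have e1 : x b - x₀ = ∑ i ∈ Finset.range (m n), (x (p n (i + 1)) - x (p n i)) := by
      rw [Finset.sum_range_sub (fun i => x (p n i)), hb, ha, hx.initial hab]
    have e2 : ∫ s in a..b, F s (x s) =
        ∑ i ∈ Finset.range (m n), ∫ s in (p n i)..(p n (i + 1)), F s (x s) := by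
      rw [intervalIntegral.sum_integral_adjacent_intervals
        (fun i hi => hFi.mono_set (hsubi n i hi)), hb, ha]
    have e3 : K = ∑ i ∈ Finset.range (m n),
        ∫ s in (p n i)..(p n (i + 1)), |Real.exp (-δ * w s) * F s (x s)| := by
      rw [intervalIntegral.sum_integral_adjacent_intervals
        (fun i hi => hF.abs.mono_set (hsubi n i hi)), hb, ha]
    rw [e1, e2, e3, Finset.mul_sum, ← Finset.sum_sub_distrib, ← Finset.sum_sub_distrib,
      Finset.mul_sum, Finset.mul_sum, ← Finset.sum_add_distrib]
    exact (Finset.abs_sum_le_sum_abs _ _).trans (Finset.sum_le_sum hterm)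
  have hlim : Tendsto (fun n => δ * ∑ i ∈ Finset.range (m n),
      (x (p n i) + x (p n (i + 1))) / 2 * (w (p n (i + 1)) - w (p n i))) atTop
      (𝓝 (x b - x₀ - ∫ s in a..b, F s (x s))) := by
    refine Metric.tendsto_nhds.2 fun η hη => ?_
    have hc : Tendsto (fun n => C ^ 2 * |δ| ^ 3 *
        ∑ i ∈ Finset.range (m n), |w (p n (i + 1)) - w (p n i)| ^ 3) atTop (𝓝 0) := by
      simpa using hcub.const_mul (C ^ 2 * |δ| ^ 3)
    -- Chosen so that `2 ε K ≤ η / 2`, also when `K = 0`.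
    have hε : 0 < η / (2 * (2 * K + 1)) := by positivity
    filter_upwards [herr _ hε, hc.eventually_lt_const (half_pos hη)] with n h1 h2
    rw [dist_comm, Real.dist_eq]
    have h3 : 2 * (η / (2 * (2 * K + 1))) * K ≤ η / 2 := by
      have : 2 * (η / (2 * (2 * K + 1))) * K = η / 2 * (2 * K / (2 * K + 1)) := by
        field_simp
      rw [this]
      refine mul_le_of_le_one_right (by positivity) ?_
      rw [div_le_one (by positivity)]
      linarith
    linarith
  have := hlim.div_const δ
  refine this.congr fun n => ?_
  rw [mul_div_cancel_left₀ _ hδ]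

end SolvesOn

/-! ### Cubic variation of processes with Gaussian increments -/

/-- A centred Gaussian of variance `r` is `√r` times a standard one, so its third absolute moment
scales like `r^{3/2}`. -/
theorem lintegral_enorm_pow_three_gaussianReal {r : ℝ} (hr : 0 ≤ r) :
    ∫⁻ x, ‖x‖ₑ ^ 3 ∂(gaussianReal 0 r.toNNReal) =
      ENNReal.ofReal (r * √r) * ∫⁻ x, ‖x‖ₑ ^ 3 ∂(gaussianReal 0 1) := by
  have hmap : (gaussianReal 0 1).map (fun x => √r * x) = gaussianReal 0 r.toNNReal := by
    rw [gaussianReal_map_const_mul, mul_zero, mul_one]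
    congr 1
    ext
    simp [Real.sq_sqrt hr, hr]
  rw [← hmap, lintegral_map (by fun_prop) (by fun_prop),
    ← lintegral_const_mul _ (by fun_prop)]
  refine lintegral_congr fun x => ?_
  have h1 : r * √r = √r ^ 3 := by
    rw [pow_succ, Real.sq_sqrt hr]
  rw [enorm_mul, mul_pow, h1, ENNReal.ofReal_pow (Real.sqrt_nonneg r),
    Real.enorm_of_nonneg (Real.sqrt_nonneg r)]

theorem lintegral_enorm_pow_three_gaussianReal_ne_top :
    ∫⁻ x, ‖x‖ₑ ^ 3 ∂(gaussianReal 0 1) ≠ ⊤ := by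
  have h := (memLp_id_gaussianReal (μ := 0) (v := 1) 3).integrable_norm_pow (p := 3) (by norm_num)
  have h2 := h.2.ne
  simpa [enorm_pow] using h2

section Gaussian

variable {Ω : Type*} [MeasurableSpace Ω] {P : Measure Ω} {W : ℝ → Ω → ℝ} {a b : ℝ}

/-- The expected sum is a constant times `∑ Δt^{3/2}`, at most `(b - a)` times the square root of
the mesh; convergence in `L¹` gives convergence in measure. -/
theorem tendstoInMeasure_sum_abs_increment_pow_three
    (hlaw : ∀ s t, s ≤ t → HasLaw (fun ω => W t ω - W s ω) (gaussianReal 0 (t - s).toNNReal) P)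
    {m : ℕ → ℕ} {p : ℕ → ℕ → ℝ} (hp : ∀ n, Monotone (p n))
    (ha : ∀ n, p n 0 = a) (hb : ∀ n, p n (m n) = b)
    (hmesh : ∀ ε > 0, ∀ᶠ n in atTop, ∀ i < m n, p n (i + 1) - p n i < ε) :
    TendstoInMeasure P (fun n ω => ∑ i ∈ Finset.range (m n),
      |W (p n (i + 1)) ω - W (p n i) ω| ^ 3) atTop fun _ => 0 := by
  set c := ∫⁻ x, ‖x‖ₑ ^ 3 ∂(gaussianReal 0 1) with hc
  have hctop : c ≠ ⊤ := lintegral_enorm_pow_three_gaussianReal_ne_top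
  have hinc : ∀ n i, AEMeasurable (fun ω => W (p n (i + 1)) ω - W (p n i) ω) P := fun n i =>
    (hlaw _ _ (hp n (Nat.le_succ i))).aemeasurable
  have hinc3 : ∀ n i, AEMeasurable (fun ω => |W (p n (i + 1)) ω - W (p n i) ω| ^ 3) P :=
    fun n i => (continuous_abs.measurable.comp_aemeasurable (hinc n i)).pow_const 3
  have hterm : ∀ n i, ∫⁻ ω, ‖|W (p n (i + 1)) ω - W (p n i) ω| ^ 3‖ₑ ∂P =
      ENNReal.ofReal ((p n (i + 1) - p n i) * √(p n (i + 1) - p n i)) * c := by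
    intro n i
    have hl := hlaw _ _ (hp n (Nat.le_succ i))
    rw [hc, ← lintegral_enorm_pow_three_gaussianReal (sub_nonneg.2 (hp n (Nat.le_succ i))),
      ← hl.map_eq, lintegral_map' (by fun_prop) hl.aemeasurable]
    refine lintegral_congr fun ω => ?_
    rw [enorm_pow, ← Real.norm_eq_abs, enorm_norm]
  have hbound : ∀ ε > 0, ∀ᶠ n in atTop, eLpNorm ((fun ω => ∑ i ∈ Finset.range (m n),
      |W (p n (i + 1)) ω - W (p n i) ω| ^ 3) - fun _ => 0) 1 P ≤
      ENNReal.ofReal ((b - a) * √ε) * c := by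
    intro ε hε
    filter_upwards [hmesh ε hε] with n hn
    rw [eLpNorm_one_eq_lintegral_enorm]
    calc _ ≤ ∫⁻ ω, ∑ i ∈ Finset.range (m n), ‖|W (p n (i + 1)) ω - W (p n i) ω| ^ 3‖ₑ ∂P := by
          refine lintegral_mono fun ω => ?_
          simp only [Pi.sub_apply, sub_zero]
          exact enorm_sum_le _ _
      _ = ∑ i ∈ Finset.range (m n),
          ENNReal.ofReal ((p n (i + 1) - p n i) * √(p n (i + 1) - p n i)) * c := by
          rw [lintegral_finsetSum' _ fun i _ => (hinc3 n i).enorm]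
          exact Finset.sum_congr rfl fun i _ => hterm n i
      _ ≤ ∑ i ∈ Finset.range (m n), ENNReal.ofReal ((p n (i + 1) - p n i) * √ε) * c := by
          refine Finset.sum_le_sum fun i hi => ?_
          gcongr
          · exact sub_nonneg.2 (hp n (Nat.le_succ i))
          · exact (hn i (Finset.mem_range.1 hi)).le
      _ = _ := by
          rw [← Finset.sum_mul, ← ENNReal.ofReal_sum_of_nonneg fun i _ =>
            mul_nonneg (sub_nonneg.2 (hp n (Nat.le_succ i))) (Real.sqrt_nonneg _),
            ← Finset.sum_mul, Finset.sum_range_sub (p n), hb, ha]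
  refine tendstoInMeasure_of_tendsto_eLpNorm one_ne_zero (fun n => ?_)
    aestronglyMeasurable_const ?_
  · exact (Finset.aemeasurable_fun_sum _ fun i _ => hinc3 n i).aestronglyMeasurable
  · refine ENNReal.tendsto_nhds_zero.2 fun η hη => ?_
    have hlim : Tendsto (fun ε : ℝ => ENNReal.ofReal ((b - a) * √ε) * c) (𝓝[>] 0) (𝓝 0) := by
      have h1 : Tendsto (fun ε : ℝ => (b - a) * √ε) (𝓝[>] 0) (𝓝 0) := by
        have : Tendsto (fun ε : ℝ => (b - a) * √ε) (𝓝 0) (𝓝 ((b - a) * √0)) :=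
          (continuous_const.mul Real.continuous_sqrt).tendsto 0
        simpa using this.mono_left nhdsWithin_le_nhds
      have h2 := ENNReal.Tendsto.mul_const (b := c) (ENNReal.tendsto_ofReal h1) (Or.inr hctop)
      simpa using h2
    obtain ⟨ε, hε, hε0⟩ := ((ENNReal.tendsto_nhds_zero.1 hlim η hη).and
      self_mem_nhdsWithin).exists
    filter_upwards [hbound ε hε0] with n hn
    exact hn.trans hε

/-- Subsequence principle: every subsequence of partitions has a further one along which the cubic
variation vanishes almost surely, and there the trapezoidal sums converge path by path. The limit is
whatever the integral equation requires. -/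
theorem isStratonovichIntegral_of_solvesOn [IsFiniteMeasure P]
    (hlaw : ∀ s t, s ≤ t → HasLaw (fun ω => W t ω - W s ω) (gaussianReal 0 (t - s).toNNReal) P)
    {F : ℝ → ℝ → ℝ} {δ x₀ : ℝ} (hδ : δ ≠ 0) (hab : a ≤ b) {Y : ℝ → Ω → ℝ}
    (hWm : ∀ t, Measurable (W t)) (hYm : ∀ t ∈ Icc a b, Measurable (Y t))
    (hWc : ∀ ω, ContinuousOn (fun t => W t ω) (Icc a b))
    (hsol : ∀ ω, SolvesOn F δ (fun t => W t ω) a b x₀ (fun t => Y t ω))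
    (hF : ∀ ω, IntervalIntegrable (fun s => Real.exp (-δ * W s ω) * F s (Y s ω)) volume a b) :
    IsStratonovichIntegral P W Y a b
      fun ω => (Y b ω - x₀ - ∫ s in a..b, F s (Y s ω)) / δ := by
  intro m p hp ha hb hmesh
  have hpI : ∀ n i, i ≤ m n → p n i ∈ Icc a b := fun n i hi =>
    ⟨by rw [← ha n]; exact hp n (Nat.zero_le i), by rw [← hb n]; exact hp n hi⟩
  refine (exists_seq_tendstoInMeasure_atTop_iff fun n => ?_).2 fun ns hns => ?_
  · refine (Finset.measurable_fun_sum _ fun i hi => ?_).aestronglyMeasurable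
    have hi' := Finset.mem_range.1 hi
    exact (((hYm _ (hpI n i hi'.le)).add (hYm _ (hpI n (i + 1) hi'))).div_const 2).mul
      ((hWm _).sub (hWm _))
  · have hcub := tendstoInMeasure_sum_abs_increment_pow_three hlaw hp ha hb hmesh
    obtain ⟨ns', hns', hae⟩ := TendstoInMeasure.exists_seq_tendsto_ae
      (f := fun k ω => ∑ i ∈ Finset.range (m (ns k)),
        |W (p (ns k) (i + 1)) ω - W (p (ns k) i) ω| ^ 3) (g := fun _ => 0)
      fun ε hε => (hcub ε hε).comp hns.tendsto_atTop
    refine ⟨ns', hns', hae.mono fun ω hω => ?_⟩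
    exact (hsol ω).tendsto_trapezoid_sum (hWc ω) (hF ω) hab hδ
      (m := fun k => m (ns (ns' k))) (p := fun k => p (ns (ns' k)))
      (fun k => hp _) (fun k => ha _) (fun k => hb _)
      (fun ε hε => (hns.comp hns').tendsto_atTop.eventually (hmesh ε hε)) hω

end Gaussian

/-! ### The Wiener shift -/

theorem wienerShift_apply (t : ℝ) (ω : WienerPath) (s : ℝ) :
    (wienerShift t ω).1 s = ω.1 (s + t) - ω.1 t := rfl

theorem wienerShift_zero (ω : WienerPath) : wienerShift 0 ω = ω := by
  apply Subtype.ext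
  ext s
  rw [wienerShift_apply, add_zero, ω.2, sub_zero]

theorem wienerShift_wienerShift (s t : ℝ) (ω : WienerPath) :
    wienerShift s (wienerShift t ω) = wienerShift (s + t) ω := by
  apply Subtype.ext
  ext r
  simp only [wienerShift_apply]
  rw [add_assoc]
  ring

theorem measurable_wienerPath_eval (t : ℝ) : Measurable fun ω : WienerPath => ω.1 t :=
  ((continuous_eval_const (F := C(ℝ, ℝ)) t).comp continuous_subtype_val).measurable

theorem measurable_wienerShift (t : ℝ) : Measurable (wienerShift t) := by
  refine Continuous.measurable (Continuous.subtype_mk ?_ _)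
  have h1 : Continuous fun ω : WienerPath =>
      ω.1.comp (⟨fun s => s + t, by fun_prop⟩ : C(ℝ, ℝ)) :=
    (ContinuousMap.continuous_precomp _).comp continuous_subtype_val
  have h2 : Continuous fun ω : WienerPath => ContinuousMap.const ℝ (ω.1 t) :=
    ContinuousMap.continuous_const'.comp
      ((continuous_eval_const (F := C(ℝ, ℝ)) t).comp continuous_subtype_val)
  exact h1.sub h2

section ShiftOn

variable {Ω₀ : Set WienerPath} (hinv : ∀ t, ∀ ω ∈ Ω₀, wienerShift t ω ∈ Ω₀)

theorem wienerShiftOn_zero (ω : Ω₀) : wienerShiftOn Ω₀ hinv 0 ω = ω :=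
  Subtype.ext (wienerShift_zero _)

theorem wienerShiftOn_wienerShiftOn (s t : ℝ) (ω : Ω₀) :
    wienerShiftOn Ω₀ hinv s (wienerShiftOn Ω₀ hinv t ω) = wienerShiftOn Ω₀ hinv (s + t) ω :=
  Subtype.ext (wienerShift_wienerShift _ _ _)

theorem wienerShiftOn_apply (t : ℝ) (ω : Ω₀) (s : ℝ) :
    (wienerShiftOn Ω₀ hinv t ω).1.1 s = ω.1.1 (s + t) - ω.1.1 t := rfl

theorem measurable_wienerShiftOn (t : ℝ) : Measurable (wienerShiftOn Ω₀ hinv t) :=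
  ((measurable_wienerShift t).comp measurable_subtype_coe).subtype_mk

end ShiftOn

theorem measurable_eval_subtype {Ω₀ : Set WienerPath} (t : ℝ) :
    Measurable fun ω : Ω₀ => ω.1.1 t :=
  (measurable_wienerPath_eval t).comp measurable_subtype_coe

theorem hasLaw_increment_comap {P : Measure WienerPath} (hP : IsWienerMeasure P)
    {Ω₀ : Set WienerPath} (hΩ₀ : MeasurableSet Ω₀) (hfull : P Ω₀ᶜ = 0) (s t : ℝ) (hst : s ≤ t) :
    HasLaw (fun ω : Ω₀ => ω.1.1 t - ω.1.1 s) (gaussianReal 0 (t - s).toNNReal)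
      (P.comap ((↑) : Ω₀ → WienerPath)) := by
  have hm : Measurable fun ω : WienerPath => ω.1 t - ω.1 s :=
    (measurable_wienerPath_eval t).sub (measurable_wienerPath_eval s)
  refine ⟨(hm.comp measurable_subtype_coe).aemeasurable, ?_⟩
  rw [← (hP.law_increment s t hst).map_eq]
  have h1 : (P.comap ((↑) : Ω₀ → WienerPath)).map ((↑) : Ω₀ → WienerPath) = P := by
    rw [map_comap_subtype_coe hΩ₀]
    exact Measure.restrict_eq_self_of_ae_mem (mem_ae_iff.2 hfull)
  conv_rhs => rw [← h1]
  rw [Measure.map_map hm measurable_subtype_coe]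
  rfl

theorem isFiniteMeasure_comap_subtype_coe {P : Measure WienerPath} [IsFiniteMeasure P]
    {Ω₀ : Set WienerPath} (hΩ₀ : MeasurableSet Ω₀) :
    IsFiniteMeasure (P.comap ((↑) : Ω₀ → WienerPath)) :=
  ⟨by rw [(MeasurableEmbedding.subtype_coe hΩ₀).comap_apply]; exact measure_lt_top _ _⟩

/-! ### Paths of sublinear growth and the absorbing radius -/

/-- Sublinear growth handles both ends and compactness the middle. The slope `ε` can be taken as
small as the exponential rates demand. -/
theorem exists_abs_le_mul_abs_add {w : ℝ → ℝ} (hw : Continuous w)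
    (htop : Tendsto (fun t => w t / t) atTop (𝓝 0))
    (hbot : Tendsto (fun t => w t / t) atBot (𝓝 0)) {ε : ℝ} (hε : 0 < ε) :
    ∃ C, 0 ≤ C ∧ ∀ r, |w r| ≤ ε * |r| + C := by
  have h0 : ∀ r : ℝ, r ≠ 0 → |w r / r| < ε → |w r| ≤ ε * |r| := fun r hr h => by
    rw [abs_div, div_lt_iff₀ (abs_pos.2 hr)] at h
    exact h.le
  have hnhds : ∀ᶠ y : ℝ in 𝓝 0, |y| < ε :=
    continuous_abs.continuousAt.eventually_lt continuousAt_const (by simpa using hε)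
  obtain ⟨T₁, hT₁⟩ := eventually_atTop.1 ((htop.eventually hnhds).and (eventually_gt_atTop 0))
  obtain ⟨T₂, hT₂⟩ := eventually_atBot.1 ((hbot.eventually hnhds).and (eventually_lt_atBot 0))
  obtain ⟨C, hC⟩ := isCompact_Icc.exists_bound_of_continuousOn (s := Icc T₂ T₁)
    hw.continuousOn
  refine ⟨max C 0, le_max_right _ _, fun r => ?_⟩
  have hC0 : 0 ≤ max C 0 := le_max_right _ _
  have hr0 : 0 ≤ ε * |r| := by positivity
  rcases le_or_gt T₁ r with h1 | h1
  · obtain ⟨h3, h4⟩ := hT₁ r h1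
    linarith [h0 r h4.ne' h3]
  rcases le_or_gt r T₂ with h2 | h2
  · obtain ⟨h3, h4⟩ := hT₂ r h2
    linarith [h0 r h4.ne h3]
  · have := (hC r ⟨h2.le, h1.le⟩).trans (le_max_left C 0)
    rw [Real.norm_eq_abs] at this
    linarith

/-- The kernel of the stationary solution of the linear equation. -/
noncomputable def radiusKernel (ν δ : ℝ) (Q : ℝ → ℝ) (w : ℝ → ℝ) (τ r : ℝ) : ℝ :=
  Real.exp (ν * (r - τ) - δ * w (r - τ)) * Q r

/-- The pullback limit of the linear equation `dx = (-ν x + Q) dt + δ x ∘ dw`. -/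
noncomputable def radius (ν δ : ℝ) (Q : ℝ → ℝ) (w : ℝ → ℝ) (τ : ℝ) : ℝ :=
  ∫ r in Iic τ, radiusKernel ν δ Q w τ r

section Radius

variable {ν δ α : ℝ} {Q w : ℝ → ℝ}

theorem radiusKernel_nonneg (hQ0 : ∀ s, 0 ≤ Q s) (τ r : ℝ) : 0 ≤ radiusKernel ν δ Q w τ r :=
  mul_nonneg (Real.exp_pos _).le (hQ0 r)

theorem intervalIntegrable_radiusKernel (hQ : LocallyIntegrable Q) (hw : Continuous w)
    (τ a b : ℝ) : IntervalIntegrable (radiusKernel ν δ Q w τ) volume a b :=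
  hQ.intervalIntegrable_of_real.continuousOn_mul (by fun_prop)

theorem radiusKernel_le (hδ : 0 < δ) (hQ0 : ∀ s, 0 ≤ Q s) {κ C : ℝ}
    (hC : ∀ r, |w r| ≤ κ / δ * |r| + C) {τ r : ℝ} (hr : r ≤ τ) :
    radiusKernel ν δ Q w τ r ≤ Real.exp ((ν - κ) * (r - τ) + δ * C) * Q r := by
  refine mul_le_mul_of_nonneg_right (Real.exp_le_exp.2 ?_) (hQ0 r)
  have h1 := hC (r - τ)
  rw [abs_of_nonpos (sub_nonpos.2 hr)] at h1
  have h2 : -w (r - τ) ≤ κ / δ * -(r - τ) + C := (neg_le_abs _).trans h1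
  have h3 := mul_le_mul_of_nonneg_left h2 hδ.le
  have h4 : δ * (κ / δ * -(r - τ) + C) = -κ * (r - τ) + δ * C := by field_simp
  rw [h4] at h3
  linarith

/-- With slope `(ν - α) / δ` the path consumes exactly the excess of `ν` over `α`, leaving `e^{αr}
Q` as a majorant on `(-∞, τ]`; beyond `τ` local integrability suffices. -/
theorem integrableOn_radiusKernel (hδ : 0 < δ) (hαν : α < ν) (hQ : LocallyIntegrable Q)
    (hQ0 : ∀ s, 0 ≤ Q s)
    (hQint : ∀ τ : ℝ, IntegrableOn (fun t => Real.exp (α * t) * Q t) (Iic τ))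
    (hw : Continuous w) (htop : Tendsto (fun t => w t / t) atTop (𝓝 0))
    (hbot : Tendsto (fun t => w t / t) atBot (𝓝 0)) (τ b : ℝ) :
    IntegrableOn (radiusKernel ν δ Q w τ) (Iic b) := by
  obtain ⟨C, hC0, hC⟩ := exists_abs_le_mul_abs_add hw htop hbot
    (div_pos (sub_pos.2 hαν) hδ : 0 < (ν - α) / δ)
  have h1 : IntegrableOn (radiusKernel ν δ Q w τ) (Iic τ) := by
    refine Integrable.mono' ((hQint τ).const_mul (Real.exp (δ * C - α * τ))) ?_ ?_
    · exact (Continuous.aestronglyMeasurable (by fun_prop)).mul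
        hQ.aestronglyMeasurable.restrict
    · refine (ae_restrict_mem measurableSet_Iic).mono fun r hr => ?_
      rw [Real.norm_of_nonneg (radiusKernel_nonneg hQ0 τ r)]
      refine (radiusKernel_le hδ hQ0 hC hr).trans (le_of_eq ?_)
      rw [← mul_assoc, ← Real.exp_add]
      ring_nf
  have h2 := (intervalIntegrable_radiusKernel (ν := ν) (δ := δ) hQ hw τ τ (max τ b)).1
  refine (h1.union h2).mono_set fun r hr => ?_
  rcases le_or_gt r τ with h | h
  · exact Or.inl h
  · exact Or.inr ⟨h, (show r ≤ b from hr).trans (le_max_right _ _)⟩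

theorem radius_nonneg (hQ0 : ∀ s, 0 ≤ Q s) (τ : ℝ) : 0 ≤ radius ν δ Q w τ :=
  setIntegral_nonneg measurableSet_Iic fun r _ => radiusKernel_nonneg hQ0 τ r

/-- Shifting time and path together only multiplies the kernel by a factor independent of `r`. -/
theorem radius_shift (τ t : ℝ) {w' : ℝ → ℝ} (hw' : ∀ s, w' s = w (s + t) - w t) :
    radius ν δ Q w' (τ + t) =
      Real.exp (-ν * t + δ * w t) * ∫ r in Iic (τ + t), radiusKernel ν δ Q w τ r := by
  rw [radius, ← integral_const_mul]
  refine integral_congr_ae (ae_of_all _ fun r => ?_)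
  simp only [radiusKernel]
  rw [← mul_assoc, ← Real.exp_add, hw', show r - (τ + t) + t = r - τ by ring]
  ring_nf

theorem tendsto_exp_mul_radius (hδ : 0 < δ) (hαν : α < ν)
    (hQ : LocallyIntegrable Q) (hQ0 : ∀ s, 0 ≤ Q s)
    (hQint : ∀ τ : ℝ, IntegrableOn (fun t => Real.exp (α * t) * Q t) (Iic τ))
    (hQtemp : ∀ c > 0, ∀ τ : ℝ, Tendsto (fun s : ℝ => Real.exp ((c - α) * s) *
      ∫ t in Iic (s + τ), Real.exp (α * t) * Q t) atBot (𝓝 0))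
    (hw : Continuous w) (htop : Tendsto (fun t => w t / t) atTop (𝓝 0))
    (hbot : Tendsto (fun t => w t / t) atBot (𝓝 0)) {c : ℝ} (hc : 0 < c) (τ : ℝ)
    {w' : ℝ → ℝ → ℝ} (hw' : ∀ t s, w' t s = w (s + t) - w t) :
    Tendsto (fun t => Real.exp (c * t) * radius ν δ Q (w' t) (τ + t)) atBot (𝓝 0) := by
  -- The path growth costs `κ` twice, once in the kernel and once in the factor `e^{δ w t}`, so the
  -- rate left is `c - 2κ > 0`. The bound `κ ≤ ν - α` keeps the spare exponent `ν - κ - α`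
  -- nonnegative, so that it can be evaluated at the endpoint.
  set κ := min (c / 4) (ν - α) with hκ
  have hκ0 : 0 < κ := lt_min (by linarith) (sub_pos.2 hαν)
  have hκc : κ ≤ c / 4 := min_le_left _ _
  have hκν : κ ≤ ν - α := min_le_right _ _
  obtain ⟨C, hC0, hC⟩ := exists_abs_le_mul_abs_add hw htop hbot (div_pos hκ0 hδ)
  have hlim := (hQtemp (c - 2 * κ) (by linarith) τ).const_mul (Real.exp (2 * δ * C - α * τ))
  rw [mul_zero] at hlim
  refine squeeze_zero' (Eventually.of_forall fun t => mul_nonneg (Real.exp_pos _).le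
    (radius_nonneg hQ0 _)) ?_ hlim
  filter_upwards [eventually_le_atBot 0] with t ht
  have h1 : ∫ r in Iic (τ + t), radiusKernel ν δ Q w τ r ≤
      Real.exp (δ * C - α * τ + (ν - κ - α) * t) *
        ∫ r in Iic (t + τ), Real.exp (α * r) * Q r := by
    rw [← integral_const_mul, add_comm t τ]
    refine setIntegral_mono_on (integrableOn_radiusKernel hδ hαν hQ hQ0 hQint hw htop hbot _ _)
      ((hQint _).const_mul _) measurableSet_Iic fun r hr => ?_
    have hr' : r ≤ τ + t := hr
    refine (radiusKernel_le hδ hQ0 hC (by linarith)).trans ?_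
    rw [← mul_assoc, ← Real.exp_add]
    refine mul_le_mul_of_nonneg_right (Real.exp_le_exp.2 ?_) (hQ0 r)
    have := mul_le_mul_of_nonneg_left (show r - τ ≤ t by linarith)
      (show 0 ≤ ν - κ - α by linarith)
    nlinarith
  have h2 : δ * w t ≤ -κ * t + δ * C := by
    have h3 := (le_abs_self _).trans (hC t)
    rw [abs_of_nonpos ht] at h3
    have h4 := mul_le_mul_of_nonneg_left h3 hδ.le
    have h5 : δ * (κ / δ * -t + C) = -κ * t + δ * C := by field_simp
    linarith
  rw [radius_shift τ t (hw' t), ← mul_assoc, ← Real.exp_add]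
  have hI0 : 0 ≤ ∫ r in Iic (t + τ), Real.exp (α * r) * Q r :=
    setIntegral_nonneg measurableSet_Iic fun r _ => mul_nonneg (Real.exp_pos _).le (hQ0 r)
  refine (mul_le_mul_of_nonneg_left h1 (Real.exp_pos _).le).trans ?_
  rw [← mul_assoc, ← mul_assoc, ← Real.exp_add, ← Real.exp_add]
  refine mul_le_mul_of_nonneg_right (Real.exp_le_exp.2 ?_) hI0
  linarith

theorem measurable_radius {Ω₀ : Set WienerPath} (hQ : LocallyIntegrable Q) (τ : ℝ) :
    Measurable fun ω : Ω₀ => radius ν δ Q (fun s => ω.1.1 s) τ := by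
  -- `Q` is measurable only up to a null set; replacing it by a measurable version leaves the
  -- integral unchanged and makes the kernel jointly measurable.
  have hQm : AEStronglyMeasurable Q volume := hQ.aestronglyMeasurable
  have e : (fun ω : Ω₀ => radius ν δ Q (fun s => ω.1.1 s) τ) =
      fun ω : Ω₀ => ∫ r in Iic τ, radiusKernel ν δ (hQm.mk Q) (fun s => ω.1.1 s) τ r := by
    funext ω
    refine integral_congr_ae (ae_restrict_of_ae ?_)
    filter_upwards [hQm.ae_eq_mk] with r hr
    simp only [radiusKernel, hr]
  rw [e]
  have hev : Measurable (Function.uncurry fun (r : ℝ) (ω : Ω₀) => ω.1.1 (r - τ)) :=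
    measurable_uncurry_of_continuous_of_measurable
      (fun ω => by fun_prop) (fun r => measurable_eval_subtype (r - τ))
  have hk : Measurable (Function.uncurry fun (ω : Ω₀) (r : ℝ) =>
      radiusKernel ν δ (hQm.mk Q) (fun s => ω.1.1 s) τ r) := by
    have h1 : Measurable fun p : Ω₀ × ℝ => p.1.1.1 (p.2 - τ) := hev.comp measurable_swap
    have h2 : Measurable fun p : Ω₀ × ℝ => (hQm.mk Q) p.2 :=
      hQm.stronglyMeasurable_mk.measurable.comp measurable_snd
    exact (((measurable_const.mul (measurable_snd.sub_const τ)).sub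
      (measurable_const.mul h1)).exp).mul h2
  exact hk.stronglyMeasurable.integral_prod_right.measurable

end Radius

/-! ### Invariance and absorption -/

section Absorption

variable {f : ℝ → ℝ → ℝ} {g h q w x : ℝ → ℝ} {δ ν : ℝ}

/-- Comparison with the linear equation, solved explicitly by variation of constants. The factor
`e^{ντ}` in `U` normalises exponents to time relative to `τ`, so that the kernel of `radius`
appears. -/
theorem SolvesOn.exp_mul_abs_le_add_integral_radiusKernel
    (hf : Continuous (fun p : ℝ × ℝ => f p.1 p.2)) (hg : LocallyIntegrable g) (hν : 0 ≤ ν)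
    (hdiss : ∀ t x, f t x * x ≤ -ν * x ^ 2 + h t * |x|) (hq : LocallyIntegrable q)
    (hle : ∀ s, |g s| + |h s| ≤ q s) (hw : Continuous w) {τ a b x₀ : ℝ} (hab : a ≤ b)
    (hx : SolvesOn (fun t x => f t x + g t) δ (fun r => w (r - τ)) a b x₀ x) :
    Real.exp (-δ * w (b - τ)) * |x b| ≤ Real.exp (-ν * (b - τ)) *
      (Real.exp (ν * (a - τ) - δ * w (a - τ)) * |x₀| +
        ∫ r in a..b, radiusKernel ν δ q w τ r) := by
  have hq0 : ∀ s, 0 ≤ q s := fun s => (by positivity : 0 ≤ |g s| + |h s|).trans (hle s)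
  have hw' : Continuous fun r => w (r - τ) := by fun_prop
  set U : ℝ → ℝ := fun s => Real.exp (ν * τ) *
    (Real.exp (ν * (a - τ) - δ * w (a - τ)) * |x₀| + ∫ r in a..s, radiusKernel ν δ q w τ r)
    with hU
  have hki := fun c d => intervalIntegrable_radiusKernel (ν := ν) (δ := δ) hq hw τ c d
  have hUc : Continuous U :=
    continuous_const.mul (continuous_const.add (intervalIntegral.continuous_primitive hki a))
  have hbound := hx.exp_mul_abs_le (ν := ν) (q := q) (m := fun s => Real.exp (-ν * s) * U s)
    hw'.continuousOn
    (intervalIntegrable_exp_mul_add hf hg hw'.continuousOn hx.1 hab)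
    (intervalIntegrable_exp_mul hw' hq a b) hν
    (fun s y hy => (le_of_dissipative hdiss s hy).trans (by linarith [hle s]))
    (fun s y hy => le_trans (by linarith [hle s]) (ge_of_dissipative hdiss s hy))
    ((by fun_prop : Continuous fun s => Real.exp (-ν * s)).mul hUc).continuousOn
    (fun s hs => by
      have := intervalIntegral.integral_nonneg (μ := volume) hs.1
        fun r _ => radiusKernel_nonneg (ν := ν) (δ := δ) (w := w) hq0 τ r
      simp only [hU]
      positivity)
    (by
      simp only [hU, intervalIntegral.integral_same, add_zero]
      rw [← mul_assoc, ← mul_assoc, ← Real.exp_add, ← Real.exp_add]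
      refine le_of_eq ?_
      congr 2
      ring)
    (fun s t has hst htb => by
      rw [exp_neg_mul_sub_eq_integral ν hst
        (β := fun r => Real.exp (ν * τ) * radiusKernel ν δ q w τ r) ((hki s t).const_mul _)
        fun r hr => ?_]
      · refine intervalIntegral.integral_congr fun r _ => ?_
        simp only [radiusKernel]
        congr 1
        rw [← mul_assoc, ← mul_assoc, ← Real.exp_add, ← Real.exp_add]
        congr 2
        ring
      · simp only [hU]
        rw [intervalIntegral.integral_const_mul,
          ← intervalIntegral.integral_add_adjacent_intervals (hki a s) (hki s r)]
        ring) b ⟨hab, le_rfl⟩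
  refine hbound.trans (le_of_eq ?_)
  simp only [hU]
  rw [← mul_assoc, ← Real.exp_add]
  congr 2
  ring

/-- The interval `[-radius, radius]` is positively invariant. -/
theorem SolvesOn.abs_le_radius (hf : Continuous (fun p : ℝ × ℝ => f p.1 p.2))
    (hg : LocallyIntegrable g) (hν : 0 ≤ ν)
    (hdiss : ∀ t x, f t x * x ≤ -ν * x ^ 2 + h t * |x|) (hq : LocallyIntegrable q)
    (hle : ∀ s, |g s| + |h s| ≤ q s) (hw : Continuous w) (hw0 : w 0 = 0) {τ : ℝ}
    (hk : ∀ b, IntegrableOn (radiusKernel ν δ q w τ) (Iic b)) {t x₀ : ℝ} (ht : 0 ≤ t)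
    (hx : SolvesOn (fun t x => f t x + g t) δ (fun r => w (r - τ)) τ (τ + t) x₀ x)
    (hx₀ : |x₀| ≤ radius ν δ q w τ) {w' : ℝ → ℝ} (hw' : ∀ s, w' s = w (s + t) - w t) :
    |x (τ + t)| ≤ radius ν δ q w' (τ + t) := by
  have h1 := hx.exp_mul_abs_le_add_integral_radiusKernel hf hg hν hdiss hq hle hw
    (le_add_of_nonneg_right ht)
  rw [sub_self, hw0, mul_zero, mul_zero, sub_zero, Real.exp_zero, one_mul,
    add_sub_cancel_left] at h1
  have h2 : ∫ r in τ..(τ + t), radiusKernel ν δ q w τ r =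
      (∫ r in Iic (τ + t), radiusKernel ν δ q w τ r) - radius ν δ q w τ :=
    (intervalIntegral.integral_Iic_sub_Iic (hk _) (hk _)).symm
  rw [radius_shift τ t hw']
  have h3 : |x (τ + t)| = Real.exp (δ * w t) * (Real.exp (-δ * w t) * |x (τ + t)|) := by
    rw [← mul_assoc, ← Real.exp_add]; simp
  rw [h3, add_comm (-ν * t), Real.exp_add, mul_assoc]
  refine mul_le_mul_of_nonneg_left (h1.trans ?_) (Real.exp_pos _).le
  exact mul_le_mul_of_nonneg_left (by linarith) (Real.exp_pos _).le

/-- Tempered initial values are absorbed in the interval `[-radius, radius]`. -/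
theorem eventually_abs_le_radius (hf : Continuous (fun p : ℝ × ℝ => f p.1 p.2))
    (hg : LocallyIntegrable g) (hh : LocallyIntegrable h) (hν : 0 < ν) (hδ : 0 < δ)
    (hdiss : ∀ t x, f t x * x ≤ -ν * x ^ 2 + h t * |x|)
    (hq : ∀ s, q s = |g s| + |h s| + 1) (hw : Continuous w) (hw0 : w 0 = 0)
    (htop : Tendsto (fun t => w t / t) atTop (𝓝 0))
    (hbot : Tendsto (fun t => w t / t) atBot (𝓝 0)) {τ : ℝ}
    (hk : IntegrableOn (radiusKernel ν δ q w τ) (Iic τ)) {β : ℝ → ℝ}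
    (hβ : Tendsto (fun t => Real.exp (ν / 2 * t) * β t) atBot (𝓝 0)) :
    ∀ᶠ t : ℝ≥0 in atTop, ∀ x x₀,
      SolvesOn (fun t x => f t x + g t) δ (fun r => w (r - τ)) (τ - t) τ x₀ x →
      |x₀| ≤ β (-t) → |x τ| ≤ radius ν δ q w τ := by
  set q₀ : ℝ → ℝ := fun s => |g s| + |h s| with hq₀
  have hq₀L : LocallyIntegrable q₀ := by
    refine LocallyIntegrable.add (fun t => ?_) (fun t => ?_)
    · exact (hg t).norm
    · exact (hh t).norm
  have hqq : q = fun s => q₀ s + 1 := funext hq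
  have h1L : LocallyIntegrable (fun _ : ℝ => (1 : ℝ)) := locallyIntegrable_const 1
  have hqL : LocallyIntegrable q := by rw [hqq]; exact hq₀L.add h1L
  have hki := fun c d => intervalIntegrable_radiusKernel (ν := ν) (δ := δ) hqL hw τ c d
  have hki₁ := fun c d => intervalIntegrable_radiusKernel (ν := ν) (δ := δ) h1L hw τ c d
  -- The summand `1` in `q` gives the radius a margin of at least `κ > 0` over what the equation
  -- needs. The vanishing contribution of the initial value fits into it, so absorption takes place
  -- in finite time.
  set κ := ∫ r in (τ - 1)..τ, radiusKernel ν δ (fun _ => 1) w τ r with hκ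
  have hκ0 : 0 < κ := intervalIntegral.intervalIntegral_pos_of_pos_on (hki₁ _ _)
    (fun r _ => mul_pos (Real.exp_pos _) one_pos) (by linarith)
  -- Half of the damping `ν` compensates the path, the other half the tempered initial values.
  obtain ⟨C, hC0, hC⟩ := exists_abs_le_mul_abs_add hw htop hbot (div_pos (half_pos hν) hδ)
  have hlim : Tendsto (fun t : ℝ≥0 =>
      Real.exp (δ * C) * (Real.exp (ν / 2 * (-t : ℝ)) * β (-t))) atTop (𝓝 0) := by
    have h1 : Tendsto (fun t : ℝ≥0 => (-t : ℝ)) atTop atBot :=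
      tendsto_neg_atTop_atBot.comp (NNReal.tendsto_coe_atTop.2 tendsto_id)
    simpa using (hβ.comp h1).const_mul (Real.exp (δ * C))
  filter_upwards [hlim.eventually_le_const hκ0, eventually_ge_atTop 1] with t ht ht1 x x₀ hx hx₀
  have ht1' : (1 : ℝ) ≤ t := by exact_mod_cast ht1
  have h1 := hx.exp_mul_abs_le_add_integral_radiusKernel hf hg hν.le hdiss hq₀L
    (fun s => le_rfl) hw (by linarith)
  rw [sub_self, hw0, mul_zero, mul_zero, Real.exp_zero, one_mul, one_mul,
    show τ - t - τ = -(t : ℝ) by ring] at h1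
  have h2 : Real.exp (ν * -(t : ℝ) - δ * w (-t)) * |x₀| ≤ κ := by
    refine le_trans ?_ ht
    rw [← mul_assoc, ← Real.exp_add]
    refine mul_le_mul (Real.exp_le_exp.2 ?_) hx₀ (abs_nonneg _) (Real.exp_pos _).le
    have h3 := (neg_le_abs _).trans (hC (-t))
    rw [abs_neg, abs_of_nonneg t.coe_nonneg] at h3
    have h4 := mul_le_mul_of_nonneg_left h3 hδ.le
    have h5 : δ * (ν / 2 / δ * (t : ℝ) + C) = ν / 2 * t + δ * C := by field_simp
    rw [h5] at h4
    linarith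
  have h3 : ∫ r in (τ - t)..τ, radiusKernel ν δ q₀ w τ r =
      (∫ r in (τ - t)..τ, radiusKernel ν δ q w τ r) -
        ∫ r in (τ - t)..τ, radiusKernel ν δ (fun _ => 1) w τ r := by
    rw [← intervalIntegral.integral_sub (hki _ _) (hki₁ _ _)]
    refine intervalIntegral.integral_congr fun r _ => ?_
    simp only [radiusKernel, hqq]
    ring
  have h4 : κ ≤ ∫ r in (τ - t)..τ, radiusKernel ν δ (fun _ => 1) w τ r :=
    intervalIntegral.integral_mono_interval (by linarith) (by linarith) le_rfl
      (ae_of_all _ fun r => radiusKernel_nonneg (fun _ => zero_le_one) τ r) (hki₁ _ _)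
  have h5 : ∫ r in (τ - t)..τ, radiusKernel ν δ q w τ r ≤ radius ν δ q w τ := by
    rw [intervalIntegral.integral_of_le (by linarith), radius]
    refine setIntegral_mono_set hk (ae_of_all _ fun r => radiusKernel_nonneg (fun s => ?_) τ r)
      (Ioc_subset_Iic_self.eventuallyLE)
    rw [hq]
    positivity
  linarith

end Absorption

/-- An adapted process whose paths are pathwise solutions is a strong solution of the
Stratonovich equation. -/
theorem isStratonovichSolution_of_isPathwiseSolution {Ω : Type*} [MeasurableSpace Ω]
    {P : Measure Ω} [IsFiniteMeasure P] {W : ℝ → Ω → ℝ} {f : ℝ → ℝ → ℝ} {g : ℝ → ℝ}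
    (hf : Continuous (fun p : ℝ × ℝ => f p.1 p.2)) (hg : LocallyIntegrable g)
    (hlaw : ∀ s t, s ≤ t → HasLaw (fun ω => W t ω - W s ω) (gaussianReal 0 (t - s).toNNReal) P)
    (hWm : ∀ t, Measurable (W t)) (hWc : ∀ ω, Continuous fun t => W t ω) {δ τ x₀ : ℝ}
    (hδ : δ ≠ 0) {Y : ℝ → Ω → ℝ}
    (hsol : ∀ ω, IsPathwiseSolution (fun t x => f t x + g t) δ (fun t => W t ω) τ x₀
      fun t => Y t ω)
    (hY : ∀ t, τ ≤ t → Measurable[⨆ r ∈ Icc τ t,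
      MeasurableSpace.comap (fun ω => W r ω - W τ ω) inferInstance] (Y t)) :
    IsStratonovichSolution P W (fun t x => f t x + g t) δ τ x₀ Y := by
  have hYm : ∀ t, τ ≤ t → Measurable (Y t) := fun t ht => (hY t ht).mono
    (iSup₂_le fun r _ => Measurable.comap_le ((hWm r).sub (hWm τ))) le_rfl
  refine ⟨fun ω => (hsol ω).1, hY, fun t ht =>
    ⟨fun ω => (Y t ω - x₀ - ∫ s in τ..t, (f s (Y s ω) + g s)) / δ, ?_,
      ae_of_all _ fun ω => ?_⟩⟩
  · exact isStratonovichIntegral_of_solvesOn (F := fun t x => f t x + g t) hlaw hδ ht hWm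
      (fun s hs => hYm s hs.1) (fun ω => (hWc ω).continuousOn) (fun ω => (hsol ω).solvesOn t)
      fun ω => intervalIntegrable_exp_mul_add hf hg (hWc ω).continuousOn
        ((hsol ω).1.mono Icc_subset_Ici_self) ht
  · simp only [mul_div_cancel₀ _ hδ]
    ring

/-! ### The main theorem -/

theorem theorem3p8
    -- the Wiener space, restricted to an invariant set of full measure of paths of sublinear growth
    (P : Measure WienerPath) (hP : IsWienerMeasure P)
    (Ω₀ : Set WienerPath) (hΩ₀ : MeasurableSet Ω₀) (hfull : P Ω₀ᶜ = 0)
    (hinv : ∀ t, ∀ ω ∈ Ω₀, wienerShift t ω ∈ Ω₀)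
    (hlin : ∀ ω ∈ Ω₀, Tendsto (fun t : ℝ => ω.1 t / t) atTop (𝓝 0) ∧
      Tendsto (fun t : ℝ => ω.1 t / t) atBot (𝓝 0))
    -- the coefficients
    (δ ν α : ℝ) (hδ : 0 < δ) (hα : 0 < α) (hαν : α < ν)
    (f : ℝ → ℝ → ℝ) (g h : ℝ → ℝ)
    (hf : ContDiff ℝ ((⊤ : ℕ∞) : WithTop ℕ∞) (fun p : ℝ × ℝ => f p.1 p.2))
    (hg : LocallyIntegrable g) (hh : LocallyIntegrable h)
    (hf0 : ∀ t, f t 0 = 0)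
    (hfdiss : ∀ t x, f t x * x ≤ -ν * x ^ 2 + h t * |x|)
    (hint : ∀ τ : ℝ, IntegrableOn (fun t => Real.exp (α * t) * (|g t| + |h t|)) (Iic τ))
    (htemp : ∀ c > 0, ∀ τ : ℝ, Tendsto (fun s : ℝ => Real.exp ((c - α) * s) *
      ∫ t in Iic (s + τ), Real.exp (α * t) * (|g t| + |h t|)) atBot (𝓝 0)) :
    -- the equation generates a unique solution cocycle `Φ`, which solves the Stratonovich equation,
    ∃ Φ : ℝ≥0 → ℝ → Ω₀ → ℝ → ℝ,
      IsSolutionCocycle (wienerShiftOn Ω₀ hinv) (fun t x => f t x + g t) δ Φ ∧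
      (∀ Φ' : ℝ≥0 → ℝ → Ω₀ → ℝ → ℝ,
        IsSolutionCocycle (wienerShiftOn Ω₀ hinv) (fun t x => f t x + g t) δ Φ' → Φ' = Φ) ∧
      IsContinuousCocycle (wienerShiftOn Ω₀ hinv) Φ ∧
      (∀ τ x₀, IsStratonovichSolution (P.comap ((↑) : Ω₀ → WienerPath))
        (fun t ω => ω.1.1 t) (fun t x => f t x + g t) δ τ x₀
        (cocycleProcess (wienerShiftOn Ω₀ hinv) Φ τ x₀)) ∧
      -- and `Φ` has a unique tempered pullback attractor, made of the `𝒟`-complete quasi-solutions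
      ∃ A : ℝ → Ω₀ → Set ℝ,
        IsPullbackAttractor (wienerShiftOn Ω₀ hinv)
          (temperedFamilies (wienerShiftOn Ω₀ hinv)) Φ A ∧
        (∀ A' : ℝ → Ω₀ → Set ℝ,
          IsPullbackAttractor (wienerShiftOn Ω₀ hinv)
            (temperedFamilies (wienerShiftOn Ω₀ hinv)) Φ A' → A' = A) ∧
        ∀ τ ω, A τ ω = {x | ∃ ξ : ℝ → Ω₀ → ℝ,
          IsDCompleteQuasiSolution (wienerShiftOn Ω₀ hinv)
            (temperedFamilies (wienerShiftOn Ω₀ hinv)) Φ ξ ∧ ξ τ ω = x} := by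
  have hf1 : ContDiff ℝ 1 (fun p : ℝ × ℝ => f p.1 p.2) := hf.of_le (by exact_mod_cast le_top)
  have hν : 0 < ν := hα.trans hαν
  have hex : ∀ w : ℝ → ℝ, ∃ X : ℝ → ℝ → ℝ → ℝ, Continuous w → ∀ τ x₀,
      IsPathwiseSolution (fun t x => f t x + g t) δ w τ x₀ (X τ x₀) := fun w => by
    by_cases hw : Continuous w
    · choose X hX using fun τ x₀ =>
        exists_isPathwiseSolution (δ := δ) hf1 hg hh hν.le hfdiss hw τ x₀
      exact ⟨X, fun _ => hX⟩
    · exact ⟨fun _ _ _ => 0, fun h => absurd h hw⟩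
  choose X hX using hex
  set θ := wienerShiftOn Ω₀ hinv with hθdef
  have hθ₀ : ∀ ω, θ 0 ω = ω := wienerShiftOn_zero hinv
  have hθ : ∀ s t ω, θ s (θ t ω) = θ (s + t) ω := wienerShiftOn_wienerShiftOn hinv
  have hθm : ∀ t, Measurable (θ t) := measurable_wienerShiftOn hinv
  have hθa : ∀ t (ω : Ω₀) s, (θ t ω).1.1 s = ω.1.1 (s + t) - ω.1.1 t :=
    wienerShiftOn_apply hinv
  have hcanc : ∀ (t : ℝ) ω, θ t (θ (-t) ω) = ω := fun t ω => by rw [hθ, add_neg_cancel, hθ₀]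
  have hcanc' : ∀ (t : ℝ) ω, θ (-t) (θ t ω) = ω := fun t ω => by rw [hθ, neg_add_cancel, hθ₀]
  have hpath : ∀ ω : Ω₀, Continuous fun t => ω.1.1 t := fun ω => ω.1.1.continuous
  set Φ : ℝ≥0 → ℝ → Ω₀ → ℝ → ℝ := fun t τ ω x =>
    X (fun s => (θ (-τ) ω).1.1 s) τ x (τ + t) with hΦdef
  have hle : ∀ (τ : ℝ) (t : ℝ≥0), τ ≤ τ + t := fun τ t => le_add_of_nonneg_right t.2
  -- The path `θ_{-τ} ω` differs from `ω(· - τ)` by a constant; the latter form suits the radius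
  -- estimates.
  have hΦX : ∀ (t : ℝ≥0) τ ω x, Φ t τ ω x = X (fun s => ω.1.1 (s - τ)) τ x (τ + t) :=
    fun t τ ω x => solution_congr_path hf1 hg hX (c := -ω.1.1 (-τ))
      ((hpath ω).comp (continuous_sub_right τ)) (hpath _) (hle τ t)
      (fun s _ => by rw [hθa, ← sub_eq_add_neg, ← sub_eq_add_neg]; rfl) x
  have hproc : ∀ τ x₀ t, τ ≤ t → ∀ ω,
      cocycleProcess θ Φ τ x₀ t ω = X (fun s => ω.1.1 s) τ x₀ t := fun τ x₀ t ht ω => by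
    simp only [cocycleProcess, hΦdef, hcanc']
    rw [Real.coe_toNNReal _ (sub_nonneg.2 ht), add_sub_cancel]
  have hsol : IsSolutionCocycle θ (fun t x => f t x + g t) δ Φ := fun τ x₀ ω => by
    have h1 := hX _ (hpath ω) τ x₀
    refine ⟨h1.1.congr fun t ht => hproc τ x₀ t ht ω, fun t ht => ?_⟩
    beta_reduce
    rw [hproc τ x₀ t ht ω, h1.2 t ht]
    congr 1
    refine intervalIntegral.integral_congr fun s hs => ?_
    rw [uIcc_of_le ht] at hs
    simp only [hproc τ x₀ s hs.1 ω]
  have huniq : ∀ Φ' : ℝ≥0 → ℝ → Ω₀ → ℝ → ℝ,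
      IsSolutionCocycle θ (fun t x => f t x + g t) δ Φ' → Φ' = Φ := fun Φ' hΦ' => by
    funext t τ ω x
    have h1 := solution_eq hf1 hg hX (hpath (θ (-τ) ω)) (hle τ t) (hΦ' τ x (θ (-τ) ω))
    simp only [cocycleProcess, hcanc, add_sub_cancel_left, Real.toNNReal_coe] at h1
    exact h1
  have hadapt : ∀ τ x₀ t, τ ≤ t → Measurable[⨆ r ∈ Icc τ t,
      MeasurableSpace.comap (fun ω : Ω₀ => ω.1.1 r - ω.1.1 τ) inferInstance]
      fun ω : Ω₀ => X (fun s => ω.1.1 s) τ x₀ t := fun τ x₀ t ht =>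
    measurable_solution hf1 hg hh hν.le hfdiss hX (W := fun t (ω : Ω₀) => ω.1.1 t) hpath ht x₀
  have hmeasX : ∀ τ x₀ t, τ ≤ t → Measurable fun ω : Ω₀ => X (fun s => ω.1.1 s) τ x₀ t :=
    fun τ x₀ t ht => (hadapt τ x₀ t ht).mono (iSup₂_le fun r _ => Measurable.comap_le
      ((measurable_eval_subtype r).sub (measurable_eval_subtype τ))) le_rfl
  have hcont : ∀ (t : ℝ≥0) τ ω, Continuous (Φ t τ ω) := fun t τ ω =>
    continuous_solution_initialValue hf1 hg hh hν.le hfdiss hX (hpath _) (hle τ t)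
  have hcoc : IsContinuousCocycle θ Φ := by
    refine ⟨fun τ => ?_, fun τ ω x => ?_, fun t s τ ω x => ?_, hcont⟩
    -- The Carathéodory argument is used twice, first with continuity in the state and then with
    -- continuity in time.
    · have h1 : ∀ t : ℝ≥0, Measurable fun p : Ω₀ × ℝ => Φ t τ p.1 p.2 := fun t => by
        have : Measurable (Function.uncurry fun (x : ℝ) (ω : Ω₀) => Φ t τ ω x) :=
          measurable_uncurry_of_continuous_of_measurable (hcont t τ)
            fun x => (hmeasX τ x (τ + t) (hle τ t)).comp (hθm (-τ))
        exact this.comp measurable_swap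
      refine measurable_uncurry_of_continuous_of_measurable
        (u := fun (t : ℝ≥0) (p : Ω₀ × ℝ) => Φ t τ p.1 p.2) (fun p => ?_) h1
      exact (hX _ (hpath (θ (-τ) p.1)) τ p.2).1.comp_continuous (by fun_prop) fun t => hle τ t
    · simp only [hΦdef, NNReal.coe_zero, add_zero]
      exact solution_initial hX (hpath _) τ x
    · have e1 : θ (-(τ + s)) (θ s ω) = θ (-τ) ω := by
        rw [hθ]
        congr 1
        ring
      simp only [hΦdef, e1]
      rw [solution_restart hf1 hg hX (hpath _) (hle τ s) (hle _ t), NNReal.coe_add,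
        add_comm (t : ℝ), add_assoc]
  have hmono : ∀ t τ ω, StrictMono (Φ t τ ω) := fun t τ ω =>
    strictMono_solution hf1 hg hX (hpath _) (hle τ t)
  refine ⟨Φ, hsol, huniq, hcoc, fun τ x₀ => ?_, ?_⟩
  · have := hP.isProbabilityMeasure
    have := isFiniteMeasure_comap_subtype_coe (P := P) hΩ₀
    refine isStratonovichSolution_of_isPathwiseSolution hf1.continuous hg
      (W := fun t (ω : Ω₀) => ω.1.1 t) (hasLaw_increment_comap hP hΩ₀ hfull)
      measurable_eval_subtype hpath hδ.ne' (hsol τ x₀) fun t ht => ?_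
    rw [funext (hproc τ x₀ t ht)]
    exact hadapt τ x₀ t ht
  · set Q : ℝ → ℝ := fun s => |g s| + |h s| + 1 with hQ
    have hQL : LocallyIntegrable Q := by
      refine LocallyIntegrable.add (LocallyIntegrable.add (fun t => ?_) (fun t => ?_))
        (locallyIntegrable_const 1)
      · exact (hg t).norm
      · exact (hh t).norm
    have hQ0 : ∀ s, 0 ≤ Q s := fun s => by positivity
    -- The constant `1` added to the forcing satisfies (g1) and (g2) because `α > 0`, so both pass
    -- to `Q`.
    have hexpi : ∀ τ : ℝ, IntegrableOn (fun t => Real.exp (α * t)) (Iic τ) := fun τ =>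
      integrableOn_exp_mul_Iic hα τ
    have hQsplit : ∀ t, Real.exp (α * t) * Q t =
        Real.exp (α * t) * (|g t| + |h t|) + Real.exp (α * t) := fun t => by
      simp only [hQ]
      ring
    have hQint : ∀ τ : ℝ, IntegrableOn (fun t => Real.exp (α * t) * Q t) (Iic τ) := fun τ => by
      simp only [hQsplit]
      exact (hint τ).add (hexpi τ)
    have hQtemp : ∀ c > 0, ∀ τ : ℝ, Tendsto (fun s : ℝ => Real.exp ((c - α) * s) *
        ∫ t in Iic (s + τ), Real.exp (α * t) * Q t) atBot (𝓝 0) := fun c hc τ => by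
      have h1 : Tendsto (fun s : ℝ => Real.exp (α * τ) / α * Real.exp (c * s)) atBot (𝓝 0) := by
        have : Tendsto (fun s : ℝ => Real.exp (c * s)) atBot (𝓝 0) :=
          Real.tendsto_exp_atBot.comp (tendsto_id.const_mul_atBot hc)
        simpa using this.const_mul (Real.exp (α * τ) / α)
      have h2 := (htemp c hc τ).add h1
      rw [add_zero] at h2
      refine h2.congr fun s => ?_
      simp only [hQsplit]
      rw [integral_add (hint _) (hexpi _), integral_exp_mul_Iic hα, mul_add]
      congr 1
      rw [div_mul_eq_mul_div, ← mul_div_assoc, ← Real.exp_add, ← Real.exp_add]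
      congr 2
      ring
    have hbot : ∀ ω : Ω₀, Tendsto (fun t : ℝ => ω.1.1 t / t) atBot (𝓝 0) := fun ω =>
      (hlin ω.1 ω.2).2
    have htop : ∀ ω : Ω₀, Tendsto (fun t : ℝ => ω.1.1 t / t) atTop (𝓝 0) := fun ω =>
      (hlin ω.1 ω.2).1
    have hk : ∀ (ω : Ω₀) τ b, IntegrableOn (radiusKernel ν δ Q (fun s => ω.1.1 s) τ) (Iic b) :=
      fun ω τ b =>
        integrableOn_radiusKernel hδ hαν hQL hQ0 hQint (hpath ω) (htop ω) (hbot ω) τ b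
    refine exists_isPullbackAttractor_of_strictMono hcoc hθ₀ hθ hθm hmono
      (ρ := fun τ ω => radius ν δ Q (fun s => ω.1.1 s) τ) (fun τ ω => radius_nonneg hQ0 τ)
      (fun τ => measurable_radius hQL τ) (fun t τ ω x hx => ?_) (fun c hc τ ω => ?_)
      (fun B hB τ ω => ?_)
    · rw [hΦX]
      exact ((hX _ ((hpath ω).comp (continuous_sub_right τ)) τ x).solvesOn
        (τ + t)).abs_le_radius hf1.continuous hg hν.le hfdiss hQL
        (fun s => le_add_of_nonneg_right zero_le_one) (hpath ω) ω.1.2 (hk ω τ) t.2 hx (hθa t ω)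
    · exact tendsto_exp_mul_radius hδ hαν hQL hQ0 hQint hQtemp (hpath ω) (htop ω) (hbot ω) hc τ
        (w' := fun t s => (θ t ω).1.1 s) fun t s => hθa t ω s
    · filter_upwards [eventually_abs_le_radius (q := Q) hf1.continuous hg hh hν hδ hfdiss
        (fun s => rfl) (hpath ω) ω.1.2 (htop ω) (hbot ω) (hk ω τ τ)
        (hB.2 (ν / 2) (half_pos hν) τ ω)] with t ht x hx
      have hw : Continuous fun s => ω.1.1 (s - τ) := (hpath ω).comp (continuous_sub_right τ)
      have e1 : Φ t (τ - t) (θ (-t) ω) x = X (fun s => ω.1.1 (s - τ)) (τ - t) x τ := by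
        rw [hΦX, sub_add_cancel]
        refine solution_congr_path hf1 hg hX (c := -ω.1.1 (-t)) hw
          ((hpath _).comp (continuous_sub_right _)) (by simp) (fun s _ => ?_) x
        simp only [Function.comp_apply]
        rw [hθa, sub_eq_add_neg (ω.1.1 _), show s - (τ - t) + -(t : ℝ) = s - τ by ring]
      rw [e1]
      refine ht _ x ((hX _ hw (τ - t) x).solvesOn τ) ?_
      -- Boundedness of the sets makes the real `sSup` an upper bound, not its default value.
      obtain ⟨C, hC⟩ := (hB.1 (τ - t) (θ (-t) ω)).2.exists_norm_le
      refine le_csSup ⟨C, ?_⟩ (mem_image_of_mem _ (by rwa [← sub_eq_add_neg]))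
      rintro _ ⟨y, hy, rfl⟩
      rw [← sub_eq_add_neg] at hy
      exact hC y hy
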